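/- Let $M^n$ be a smooth Riemannian manifold with Levi-Civita connection $\nabla^{LC}$, let $E\to M$ be a smooth real vector bundle of finite rank with a smooth fibre metric, and let $A$ be a smooth metric connection on $E$, with curvature $F\in\Gamma(\Lambda^2T^*M\otimes\operatorname{End}E)$, $F(X,Y)=\nabla_X\nabla_Y-\nabla_Y\nabla_X-\nabla_{[X,Y]}$. Let $\nabla$ also denote the connection on $\Lambda^2T^*M\otimes\operatorname{End}E$ induced by $\nabla^{LC}$ and $A$. Suppose that $A$ is a Yang–Mills connection, that is, $d^*F=0$, where $d^*$ is the codifferential $(d^*\varphi)(v)=-\sum_i(\nabla_{e_i}\varphi)(e_i,v)$, with $(e_i)$ an orthonormal basis of the tangent space (the formal adjoint of the covariant exterior derivative). Norms are the pointwise norms induced by the metrics: $|\varphi|^2=\sum_{i<j}|\varphi(e_i,e_j)|^2$ with $|T|^2=\operatorname{tr}(T^{T}T)$ on $\operatorname{End}E$, and $|\nabla\varphi|^2=\sum_k|\nabla_{e_k}\varphi|^2$. Then the function $|F|$ is differentiable at every point where $F\neq 0$, and at every point of $M$ where $|F|$ is differentiable (in particular wherever $F\ne0$) $$|\nabla F|^2\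 \ge\ \Bigl(1+\min\bigl\{\tfrac12,\tfrac1{n-2}\bigr\}\Bigr)\,\bigl|d|F|\bigr|^2 ,$$ where for $n=2$ we put $\tfrac1{0}=\infty$, so that the minimum is $\tfrac12$ (for $n\le1$ one has $F=0$, both sides vanish, and the minimum may be read as $\tfrac12$). -/

import Mathlib

open Bundle FiberBundle
open scoped Manifold ContDiff Bundle

noncomputable section

namespace YangMillsKato

section Definitions

variable {n : ℕ} {M : Type*} [TopologicalSpace M] [ChartedSpace (EuclideanSpace ℝ (Fin n)) M]
  [IsManifold (𝓡 n) ∞ M]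
  [RiemannianBundle (fun x : M ↦ TangentSpace (𝓡 n) x)]
  [IsContMDiffRiemannianBundle (𝓡 n) ∞ (EuclideanSpace ℝ (Fin n))
    (fun x : M ↦ TangentSpace (𝓡 n) x)]
  {W : Type*} [NormedAddCommGroup W] [NormedSpace ℝ W] [FiniteDimensional ℝ W]
  {E : M → Type*} [TopologicalSpace (TotalSpace W E)]
  [∀ x, NormedAddCommGroup (E x)] [∀ x, InnerProductSpace ℝ (E x)]
  [FiberBundle W E] [VectorBundle ℝ W E]

/-- A connection `D` on the tangent bundle of a Riemannian manifold is the Levi-Civita connection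
if it is compatible with the Riemannian metric and torsion-free. -/
def IsLeviCivita (D : CovariantDerivative (𝓡 n) (EuclideanSpace ℝ (Fin n))
    (fun x : M ↦ TangentSpace (𝓡 n) x)) : Prop :=
  haveI : IsContMDiffRiemannianBundle (𝓡 n) 1 (EuclideanSpace ℝ (Fin n))
    (fun x : M ↦ TangentSpace (𝓡 n) x) :=
    IsContMDiffRiemannianBundle.of_le (n := ∞) ENat.LEInfty.out
  D.IsMetricCompatible ∧ D.torsion = 0

/-- The curvature operator `∇_X ∇_Y s - ∇_Y ∇_X s - ∇_[X,Y] s` on vector fields `X`, `Y` and a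
section `s`. Mathlib writes `∇_X s` at `x` as `A s x (X x)`. -/
def curvatureOp (A : CovariantDerivative (𝓡 n) W E) (X Y : Π x : M, TangentSpace (𝓡 n) x)
    (s : Π x : M, E x) (x : M) : E x :=
  A (fun y ↦ A s y (Y y)) x (X x) - A (fun y ↦ A s y (X y)) x (Y x)
    - A s x (VectorField.mlieBracket (𝓡 n) X Y x)

variable (n E) in
/-- The type of (not necessarily smooth or alternating) sections of `T*M ⊗ T*M ⊗ End E`: at each
point, two tangent vectors and a vector of the fibre are sent to a vector of the fibre. -/
abbrev EndForm : Type _ :=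
  Π x : M, TangentSpace (𝓡 n) x → TangentSpace (𝓡 n) x → E x → E x

/-- The curvature `F` of a connection, as an `End E`-valued two-form. Since the curvature operator
is tensorial, its value on vectors at `x` is computed with any smooth local extensions of them;
`FiberBundle.extend` is one that is constant in a local trivialization around `x`. -/
def curvature (A : CovariantDerivative (𝓡 n) W E) : EndForm n E :=
  fun x u v e ↦ curvatureOp A (extend (EuclideanSpace ℝ (Fin n)) u)
    (extend (EuclideanSpace ℝ (Fin n)) v) (extend W e) x

/-- The covariant derivative of an `End E`-valued form `φ`, with respect to the connection induced
by `D` on `T*M` and by `A` on `E`: `covDeriv D A φ x w u v e` is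
`((∇_w φ)(u, v)) e = ∇_w (φ(U, V) s) - φ(∇_w U, v) e - φ(u, ∇_w V) e - φ(u, v) (∇_w s)`
for local extensions `U`, `V`, `s` of `u`, `v`, `e`. -/
def covDeriv (D : CovariantDerivative (𝓡 n) (EuclideanSpace ℝ (Fin n))
      (fun x : M ↦ TangentSpace (𝓡 n) x))
    (A : CovariantDerivative (𝓡 n) W E) (φ : EndForm n E) (x : M)
    (w u v : TangentSpace (𝓡 n) x) (e : E x) : E x :=
  A (fun y ↦ φ y (extend (EuclideanSpace ℝ (Fin n)) u y)
      (extend (EuclideanSpace ℝ (Fin n)) v y) (extend W e y)) x w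
    - φ x (D (extend (EuclideanSpace ℝ (Fin n)) u) x w) v e
    - φ x u (D (extend (EuclideanSpace ℝ (Fin n)) v) x w) e
    - φ x u v (A (extend W e) x w)

/-- An orthonormal basis of the tangent space at `x`. -/
def tangentONB (x : M) : OrthonormalBasis
    (Fin (Module.finrank ℝ (TangentSpace (𝓡 n) x))) ℝ (TangentSpace (𝓡 n) x) :=
  haveI : FiniteDimensional ℝ (TangentSpace (𝓡 n) x) :=
    VectorBundle.finiteDimensional ℝ (EuclideanSpace ℝ (Fin n))
      (fun x : M ↦ TangentSpace (𝓡 n) x) x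
  stdOrthonormalBasis ℝ (TangentSpace (𝓡 n) x)

variable (W E) in
/-- An orthonormal basis of the fibre at `x`. -/
def fiberONB (x : M) : OrthonormalBasis (Fin (Module.finrank ℝ (E x))) ℝ (E x) :=
  haveI : FiniteDimensional ℝ (E x) := VectorBundle.finiteDimensional ℝ W E x
  stdOrthonormalBasis ℝ (E x)

variable (W) in
/-- The pointwise norm `|φ|` of an `End E`-valued two-form,
`|φ|² = ∑_{i < j} |φ(e_i, e_j)|² = (1 / 2) ∑_{i, j} |φ(e_i, e_j)|²`, where endomorphisms carry the
Hilbert-Schmidt norm `|T|² = tr(Tᵀ T) = ∑_a |T f_a|²`. -/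
def formNorm (φ : EndForm n E) (x : M) : ℝ :=
  Real.sqrt ((1 / 2) * ∑ i, ∑ j, ∑ a,
    ‖φ x (tangentONB x i) (tangentONB x j) (fiberONB W E x a)‖ ^ 2)

/-- The squared pointwise norm `|∇φ|² = ∑_k |∇_{e_k} φ|²` of the covariant derivative of an
`End E`-valued two-form. -/
def covDerivNormSq (D : CovariantDerivative (𝓡 n) (EuclideanSpace ℝ (Fin n))
      (fun x : M ↦ TangentSpace (𝓡 n) x))
    (A : CovariantDerivative (𝓡 n) W E) (φ : EndForm n E) (x : M) : ℝ :=
  ∑ k, (1 / 2) * ∑ i, ∑ j, ∑ a,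
    ‖covDeriv D A φ x (tangentONB x k) (tangentONB x i) (tangentONB x j) (fiberONB W E x a)‖ ^ 2

/-- The codifferential `d*` on `End E`-valued two-forms, the formal adjoint of the covariant
exterior derivative: `d* φ (v) = - ∑_i (∇_{e_i} φ)(e_i, v)`. -/
def codifferential (D : CovariantDerivative (𝓡 n) (EuclideanSpace ℝ (Fin n))
      (fun x : M ↦ TangentSpace (𝓡 n) x))
    (A : CovariantDerivative (𝓡 n) W E) (φ : EndForm n E) (x : M)
    (v : TangentSpace (𝓡 n) x) (e : E x) : E x :=
  - ∑ i, covDeriv D A φ x (tangentONB x i) (tangentONB x i) v e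

/-- The Yang-Mills equation `d* F = 0` for the curvature `F` of `A`. -/
def IsYangMills (D : CovariantDerivative (𝓡 n) (EuclideanSpace ℝ (Fin n))
      (fun x : M ↦ TangentSpace (𝓡 n) x))
    (A : CovariantDerivative (𝓡 n) W E) : Prop :=
  ∀ (x : M) (v : TangentSpace (𝓡 n) x) (e : E x), codifferential D A (curvature A) x v e = 0

end Definitions

/-- The constant `min {1 / 2, 1 / (n - 2)}` for `n ≥ 3`, with the convention `1 / 0 = ∞` for
`n = 2`. (For `n ≤ 1` there are no nonzero two-forms.) -/
def katoConst (n : ℕ) : ℝ :=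
  if n ≤ 2 then 1 / 2 else min (1 / 2) (1 / ((n : ℝ) - 2))

end YangMillsKato

end

/-!
The inequality is an algebraic statement about `F` and `∇F` at one point, once three facts are known
about `∇F`, a one-form with values in two-forms: it is closed (the second Bianchi identity,
`covDeriv_curvature_cyclic`), it is trace-free (the Yang-Mills equation), and pairing it with `F`
gives the derivative of `|F|² / 2` (`mvfderiv_sum_norm_sq_curvature`, which uses that both
connections are metric).

For the algebra (`refined_kato_pointwise`), let `a` be the gradient of `|F|² / 2`. The plain Kato
inequality is the Cauchy-Schwarz inequality for `⟨∇F, a ⊗ F⟩ = |a|²`. Being closed and trace-free,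
`∇F` is orthogonal to the cyclic sums and to the pure trace families, so `a ⊗ F` may be replaced by
its component `θ` orthogonal to both. With `η = ι_a F`, that component has norm
`|θ|² = |a|² |F|² - (|a|² |F|² - |η|²) / 3 - |η|² / (n - 1)`, and `0 ≤ |η|² ≤ |a|² |F|²` shows that
`|θ|²` is at most `|a|² |F|²` times the larger of `2 / 3` and `(n - 2) / (n - 1)`; the inverse of
this factor is the constant of the theorem.

The forms `F` and `∇F` are defined by particular local extensions of vectors. The calculus rules are
available in other extensions because curvature and its covariant derivative are tensors: an
operator on sections that is additive and homogeneous over functions depends only on the value at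
the point (`smooth_tensorial_congr`). The norm is also defined by an orthonormal basis chosen at
each point without regard to continuity; it agrees with the norm computed in a smooth orthonormal
frame (`exists_orthonormal_frame`, `sum_norm_sq_trilinear_eq`), so `|F|²` is smooth and `|F|` is
smooth where `F ≠ 0`. Where `F = 0` and `|F|` is differentiable, `|F|` has a minimum and its
derivative vanishes.
-/

open Filter VectorField
open scoped Topology

noncomputable section

/-! ### The algebraic inequality -/

namespace YangMillsKato

section Algebra

lemma katoConst_nonneg {n : ℕ} : 0 ≤ katoConst n := by
  unfold katoConst
  split_ifs with h
  · norm_num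
  · have : (2 : ℝ) < n := by exact_mod_cast not_le.1 h
    exact le_min (by norm_num) (div_nonneg one_pos.le (by linarith))

lemma katoConst_le_half {n : ℕ} : katoConst n ≤ 1 / 2 := by
  unfold katoConst
  split_ifs with h
  · exact le_rfl
  · exact min_le_left _ _

lemma katoConst_mul_le_one {n : ℕ} : katoConst n * ((n : ℝ) - 2) ≤ 1 := by
  unfold katoConst
  split_ifs with h
  · have : (n : ℝ) ≤ 2 := by exact_mod_cast h
    linarith
  · have : (2 : ℝ) < n := by exact_mod_cast not_le.1 h
    have h2 : (0 : ℝ) < n - 2 := by linarith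
    calc _ ≤ 1 / ((n : ℝ) - 2) * (n - 2) := by gcongr; exact min_le_right _ _
      _ = 1 := by field_simp

variable {ι : Type*} [Fintype ι] {G : Type*} [NormedAddCommGroup G] [InnerProductSpace ℝ G]

/-- The inner product of families indexed by triples. -/
def tensorInner (X Y : ι → ι → ι → G) : ℝ := ∑ k, ∑ i, ∑ j, inner ℝ (X k i j) (Y k i j)

/-- The sum over the cyclic permutations of the indices. -/
def cyclicSum (X : ι → ι → ι → G) (k i j : ι) : G := X k i j + X i j k + X j k i

/-- The family `δ_ki η_j - δ_kj η_i`; among the families that are skew in the last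
two indices, these are the ones orthogonal to the trace-free ones. -/
def traceFamily [DecidableEq ι] (η : ι → G) (k i j : ι) : G :=
  (if k = i then η j else 0) - (if k = j then η i else 0)

lemma tensorInner_comm (X Y : ι → ι → ι → G) : tensorInner X Y = tensorInner Y X := by
  simp only [tensorInner, real_inner_comm]

lemma tensorInner_sub_left (X Y Z : ι → ι → ι → G) :
    tensorInner (X - Y) Z = tensorInner X Z - tensorInner Y Z := by
  simp [tensorInner, inner_sub_left, Finset.sum_sub_distrib]

lemma tensorInner_smul_left (c : ℝ) (X Y : ι → ι → ι → G) :
    tensorInner (c • X) Y = c * tensorInner X Y := by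
  simp [tensorInner, inner_smul_left, Finset.mul_sum]

lemma tensorInner_sub_right (X Y Z : ι → ι → ι → G) :
    tensorInner X (Y - Z) = tensorInner X Y - tensorInner X Z := by
  simp [tensorInner, inner_sub_right, Finset.sum_sub_distrib]

lemma tensorInner_smul_right (c : ℝ) (X Y : ι → ι → ι → G) :
    tensorInner X (c • Y) = c * tensorInner X Y := by
  simp [tensorInner, inner_smul_right, Finset.mul_sum]

lemma tensorInner_self_nonneg (X : ι → ι → ι → G) : 0 ≤ tensorInner X X :=
  Finset.sum_nonneg fun _ _ ↦ Finset.sum_nonneg fun _ _ ↦ Finset.sum_nonneg fun _ _ ↦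
    real_inner_self_nonneg

/-- The cyclic sum is self-adjoint. -/
lemma tensorInner_cyclicSum (X Y : ι → ι → ι → G) :
    tensorInner X (cyclicSum Y) = tensorInner (cyclicSum X) Y := by
  have rot (f : ι → ι → ι → ℝ) : ∑ k, ∑ i, ∑ j, f k i j = ∑ k, ∑ i, ∑ j, f j k i := by
    rw [Finset.sum_comm]
    exact Finset.sum_congr rfl fun i _ ↦ Finset.sum_comm
  simp only [tensorInner, cyclicSum, inner_add_left, inner_add_right, Finset.sum_add_distrib]
  rw [rot fun k i j ↦ inner ℝ (X k i j) (Y i j k), rot fun k i j ↦ inner ℝ (X i j k) (Y k i j)]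
  ring

lemma tensorInner_traceFamily [DecidableEq ι] (X : ι → ι → ι → G) (η : ι → G)
    (hX : ∀ k i j, X k i j = - X k j i) :
    tensorInner X (traceFamily η) = 2 * ∑ j, inner ℝ (∑ k, X k k j) (η j) := by
  have h1 : ∑ k, ∑ i, ∑ j, inner ℝ (X k i j) (if k = i then η j else 0) =
      ∑ j, inner ℝ (∑ k, X k k j) (η j) := by
    simp_rw [sum_inner]
    conv_rhs => rw [Finset.sum_comm]
    refine Finset.sum_congr rfl fun k _ ↦ ?_
    rw [Finset.sum_eq_single k]
    · simp
    · intro i _ hi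
      simp [Ne.symm hi]
    · simp
  have h2 : ∑ k, ∑ i, ∑ j, inner ℝ (X k i j) (if k = j then η i else 0) =
      - ∑ j, inner ℝ (∑ k, X k k j) (η j) := by
    rw [← h1]
    simp_rw [← Finset.sum_neg_distrib]
    refine Finset.sum_congr rfl fun k _ ↦ ?_
    rw [Finset.sum_comm]
    refine Finset.sum_congr rfl fun i _ ↦ Finset.sum_congr rfl fun j _ ↦ ?_
    rw [hX, inner_neg_left]
  simp only [tensorInner, traceFamily, inner_sub_right, Finset.sum_sub_distrib]
  rw [h1, h2]
  ring

lemma le_of_forall_quadratic_nonneg {κ w g P T : ℝ} (hκ : 0 ≤ κ) (hw : 0 < w)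
    (hT : (1 + κ) * T ≤ 2 * (g * w)) (h : ∀ t, 0 ≤ P - 2 * t * (2 * g) + t ^ 2 * T) :
    2 * ((1 + κ) * g) ≤ P * w := by
  -- this `t` minimizes the quadratic polynomial when the bound on `T` is an equality
  have h1 := mul_nonneg (h ((1 + κ) / w)) hw.le
  have h2 : (P - 2 * ((1 + κ) / w) * (2 * g) + ((1 + κ) / w) ^ 2 * T) * w =
      P * w - 4 * ((1 + κ) * g) + (1 + κ) / w * ((1 + κ) * T) := by
    field_simp
    ring
  have h3 : (1 + κ) / w * ((1 + κ) * T) ≤ (1 + κ) / w * (2 * (g * w)) := by gcongr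
  have h4 : (1 + κ) / w * (2 * (g * w)) = 2 * ((1 + κ) * g) := by field_simp
  linarith

lemma eq_zero_of_eq_neg_self {v : G} (h : v = -v) : v = 0 := by
  have h2 : (2 : ℝ) • v = 0 := by
    rw [two_smul]
    nth_rewrite 2 [h]
    exact add_neg_cancel v
  simpa using h2

/-- The refined Kato inequality at a point. Here `φ` plays the role of the two-form, `ψ` that of its
covariant derivative, which is closed and coclosed, and `a` is the gradient of `|φ|² / 2`.

The hypotheses say that `ψ` is orthogonal to all families `cyclicSum X` and `traceFamily η`. So
in `⟨ψ, a ⊗ φ⟩ = 2|a|²` one may replace `a ⊗ φ` by its component `θ` orthogonal to these, whose norm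
is smaller by the factor that gives the constant. -/
theorem refined_kato_pointwise [DecidableEq ι] (φ : ι → ι → G) (ψ : ι → ι → ι → G) (a : ι → ℝ)
    (hφ : ∀ i j, φ i j = - φ j i) (hψ : ∀ k i j, ψ k i j = - ψ k j i)
    (hcyc : ∀ k i j, ψ k i j + ψ i j k + ψ j k i = 0) (htr : ∀ j, ∑ i, ψ i i j = 0)
    (ha : ∀ k, a k = (1 / 2) * ∑ i, ∑ j, inner ℝ (ψ k i j) (φ i j)) :
    (1 + katoConst (Fintype.card ι)) * ∑ k, a k ^ 2 ≤
      (∑ k, (1 / 2) * ∑ i, ∑ j, ‖ψ k i j‖ ^ 2) * ((1 / 2) * ∑ i, ∑ j, ‖φ i j‖ ^ 2) := by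
  set κ := katoConst (Fintype.card ι)
  set n : ℝ := (Fintype.card ι : ℝ) with hn
  have hκ0 : 0 ≤ κ := katoConst_nonneg
  have hκ1 : κ ≤ 1 / 2 := katoConst_le_half
  have hκ2 : κ * (n - 2) ≤ 1 := katoConst_mul_le_one
  set w := (1 / 2) * ∑ i, ∑ j, ‖φ i j‖ ^ 2 with hw
  set g := ∑ k, a k ^ 2 with hg
  have hg0 : 0 ≤ g := Finset.sum_nonneg fun _ _ ↦ sq_nonneg _
  have hψψ : ∑ k, (1 / 2) * ∑ i, ∑ j, ‖ψ k i j‖ ^ 2 = (1 / 2) * tensorInner ψ ψ := by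
    simp only [tensorInner, real_inner_self_eq_norm_sq, Finset.mul_sum]
  rw [hψψ]
  have hw0 : 0 ≤ w := mul_nonneg (by norm_num) <|
    Finset.sum_nonneg fun _ _ ↦ Finset.sum_nonneg fun _ _ ↦ sq_nonneg _
  rcases hw0.eq_or_lt with hw0 | hw0
  · have hφ0 (i j) : φ i j = 0 := by
      have h1 : ∑ i, ∑ j, ‖φ i j‖ ^ 2 = 0 := by linarith
      rw [Finset.sum_eq_zero_iff_of_nonneg
        fun _ _ ↦ Finset.sum_nonneg fun _ _ ↦ sq_nonneg _] at h1
      have h2 := h1 i (Finset.mem_univ i)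
      rw [Finset.sum_eq_zero_iff_of_nonneg fun _ _ ↦ sq_nonneg _] at h2
      simpa using h2 j (Finset.mem_univ j)
    have : g = 0 := by simp [hg, ha, hφ0]
    rw [this, ← hw0]; simp
  -- in dimension at most one there are no nonzero skew families
  have hn2 : 0 < n - 1 := by
    by_contra h
    have hcard : Fintype.card ι ≤ 1 := by
      rw [hn, sub_pos, not_lt] at h; exact_mod_cast h
    have := Fintype.card_le_one_iff_subsingleton.1 hcard
    have hφ0 (i j) : φ i j = 0 := by
      have h1 := hφ i j
      rw [Subsingleton.elim j i] at h1 ⊢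
      exact eq_zero_of_eq_neg_self h1
    rw [hw] at hw0
    simp [hφ0] at hw0
  let S (k i j : ι) : G := a k • φ i j
  let η (j : ι) : G := ∑ m, a m • φ m j
  have hS (k i j) : S k i j = - S k j i := by simp only [S]; rw [hφ, smul_neg]
  have hC (k i j) : cyclicSum S k i j = - cyclicSum S k j i := by
    simp only [S, cyclicSum]; rw [hφ i j, hφ j k, hφ k i]; module
  have hT (k i j) : traceFamily η k i j = - traceFamily η k j i := by
    simp only [traceFamily]; abel
  set H := ∑ j, ‖η j‖ ^ 2 with hH
  have hH0 : 0 ≤ H := Finset.sum_nonneg fun _ _ ↦ sq_nonneg _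
  have hψS : tensorInner ψ S = 2 * g := by
    simp only [tensorInner, S, inner_smul_right, ← Finset.mul_sum, hg]
    rw [Finset.mul_sum]
    refine Finset.sum_congr rfl fun k _ ↦ ?_
    have := ha k
    linear_combination (- 2 * a k) * this
  have hψC : tensorInner ψ (cyclicSum S) = 0 := by
    rw [tensorInner_cyclicSum]
    simp [tensorInner, cyclicSum, hcyc]
  have hψT : tensorInner ψ (traceFamily η) = 0 := by
    rw [tensorInner_traceFamily _ _ hψ]
    simp [htr]
  have hSS : tensorInner S S = 2 * (g * w) := by
    simp only [tensorInner, S, real_inner_self_eq_norm_sq, norm_smul, mul_pow, ← Finset.mul_sum,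
      Real.norm_eq_abs, sq_abs, ← Finset.sum_mul, hg, hw]
    ring
  have hSC : tensorInner S (cyclicSum S) = 2 * (g * w) - 2 * H := by
    have hHexp : H = ∑ j, ∑ i, ∑ k, a i * a k * inner ℝ (φ i j) (φ k j) := by
      refine Finset.sum_congr rfl fun j _ ↦ ?_
      simp only [η, ← real_inner_self_eq_norm_sq, sum_inner, inner_sum, inner_smul_left,
        inner_smul_right, RCLike.conj_to_real]
      refine Finset.sum_congr rfl fun i _ ↦ ?_
      rw [Finset.mul_sum]
      exact Finset.sum_congr rfl fun k _ ↦ by rw [real_inner_comm]; ring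
    have hQ1 : ∑ k, ∑ i, ∑ j, inner ℝ (S k i j) (S i j k) = - H := by
      have (k i j : ι) : inner ℝ (S k i j) (S i j k) = - (a i * a k * inner ℝ (φ i j) (φ k j)) := by
        simp only [S, inner_smul_left, inner_smul_right, RCLike.conj_to_real]
        rw [hφ j k, inner_neg_right]
        ring
      simp_rw [this, Finset.sum_neg_distrib, hHexp]
      rw [neg_inj, Finset.sum_comm]
      simp_rw [Finset.sum_comm (s := Finset.univ (α := ι)) (t := Finset.univ (α := ι))
        (f := fun k j ↦ a _ * a k * inner ℝ (φ _ j) (φ k j))]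
      exact Finset.sum_comm
    have hQ2 : ∑ k, ∑ i, ∑ j, inner ℝ (S k i j) (S j k i) = - H := by
      rw [← hQ1]
      refine Finset.sum_congr rfl fun k _ ↦ ?_
      rw [Finset.sum_comm]
      refine Finset.sum_congr rfl fun i _ ↦ Finset.sum_congr rfl fun j _ ↦ ?_
      rw [hS k j i, hS i k j, inner_neg_neg]
    have := hSS
    simp only [tensorInner, cyclicSum, inner_add_right, Finset.sum_add_distrib] at this ⊢
    rw [this, hQ1, hQ2]
    ring
  have hCC : tensorInner (cyclicSum S) (cyclicSum S) = 3 * (2 * (g * w) - 2 * H) := by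
    rw [tensorInner_cyclicSum, tensorInner_comm, ← hSC, ← tensorInner_smul_right]
    congr 1
    funext k i j
    simp only [cyclicSum, Pi.smul_apply]
    module
  have hST : tensorInner S (traceFamily η) = 2 * H := by
    rw [tensorInner_traceFamily _ _ hS, hH]
    simp only [S, η, real_inner_self_eq_norm_sq]
  have hCT : tensorInner (cyclicSum S) (traceFamily η) = 0 := by
    rw [tensorInner_traceFamily _ _ hC]
    have (k j : ι) : cyclicSum S k k j = 0 := by
      have h0 : φ k k = 0 := eq_zero_of_eq_neg_self (hφ k k)
      simp only [S, cyclicSum]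
      rw [hφ k j, h0]; module
    simp [this]
  have hTT : tensorInner (traceFamily η) (traceFamily η) = 2 * ((n - 1) * H) := by
    rw [tensorInner_traceFamily _ _ hT]
    have (j : ι) : ∑ k, traceFamily η k k j = (n - 1) • η j := by
      simp [traceFamily, Finset.sum_sub_distrib, hn, sub_smul, Nat.cast_smul_eq_nsmul]
    simp only [this, inner_smul_left, real_inner_self_eq_norm_sq, ← Finset.mul_sum, hH]
    simp
  -- `H = |η|²` is at most `|a|² |φ|²`, because the cyclic sum of `S` has nonnegative norm
  have hNH : 0 ≤ g * w - H := by
    have := tensorInner_self_nonneg (cyclicSum S)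
    linarith
  -- the cyclic sum is three times a projection, and the trace family has trace `(n - 1) η`
  set θ := S - (1 / 3 : ℝ) • cyclicSum S - (1 / (n - 1)) • traceFamily η
  have hψθ : tensorInner ψ θ = 2 * g := by
    simp only [θ, tensorInner_sub_right, tensorInner_smul_right, hψS, hψC, hψT]
    ring
  have hθθ : tensorInner θ θ = 2 * (g * w - (1 / 3) * (g * w - H) - 1 / (n - 1) * H) := by
    simp only [θ, tensorInner_sub_right, tensorInner_smul_right, tensorInner_sub_left,
      tensorInner_smul_left, tensorInner_comm (cyclicSum S) S, tensorInner_comm (traceFamily η) S,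
      tensorInner_comm (traceFamily η) (cyclicSum S), hSS, hSC, hCC, hST, hCT, hTT]
    field_simp
    ring
  have hθ : (1 + κ) * tensorInner θ θ ≤ 2 * (g * w) := by
    clear_value w g H κ n
    have h1 : κ * (g * w - H) ≤ (1 + κ) * ((1 / 3) * (g * w - H)) := by
      rw [← mul_assoc]; gcongr; linarith
    have h2 : κ * H ≤ (1 + κ) * (1 / (n - 1) * H) := by
      rw [← mul_assoc]
      gcongr
      rw [mul_one_div, le_div_iff₀ hn2]
      linarith
    rw [hθθ]
    linarith
  -- Cauchy-Schwarz for `ψ` and `θ`, in a form that needs no division by `|θ|`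
  have hpos (t : ℝ) : 0 ≤ tensorInner ψ ψ - 2 * t * (2 * g) + t ^ 2 * tensorInner θ θ := by
    have := tensorInner_self_nonneg (ψ - t • θ)
    simp only [tensorInner_sub_right, tensorInner_smul_right, tensorInner_sub_left,
      tensorInner_smul_left, tensorInner_comm θ ψ, hψθ] at this
    linarith
  have := le_of_forall_quadratic_nonneg hκ0 hw0 hθ hpos
  linarith

end Algebra

end YangMillsKato

/-! ### Sections smooth near a point -/

namespace YangMillsKato

section SmoothSections

variable {B H M : Type*} [NormedAddCommGroup B] [NormedSpace ℝ B] [TopologicalSpace H]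
  {I : ModelWithCorners ℝ B H} [TopologicalSpace M] [ChartedSpace H M]
  {F : Type*} [NormedAddCommGroup F] [NormedSpace ℝ F]
  {V : M → Type*} [TopologicalSpace (TotalSpace F V)]
  [∀ x, TopologicalSpace (V x)]
  [FiberBundle F V]

variable (I F) in
/-- A section is smooth near `x` if it is smooth at every point of a neighbourhood of `x`.
(Being `C^∞` at `x` alone would only give, for each finite `k`, a neighbourhood on which the section
is `C^k`.) -/
def SmoothNear (σ : Π x : M, V x) (x : M) : Prop :=
  ∀ᶠ y in 𝓝 x, CMDiffAt ∞ (T% σ) y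

variable (I) in
/-- A real function is smooth near `x` if it is smooth at every point of a neighbourhood. -/
def FunSmoothNear (f : M → ℝ) (x : M) : Prop :=
  ∀ᶠ y in 𝓝 x, CMDiffAt ∞ f y

variable {σ τ : Π x : M, V x} {f g : M → ℝ} {x : M}

lemma SmoothNear.eventually (h : SmoothNear I F σ x) : ∀ᶠ y in 𝓝 x, SmoothNear I F σ y :=
  eventually_eventually_nhds.2 h

lemma SmoothNear.mdifferentiableAt (h : SmoothNear I F σ x) : MDiffAt (T% σ) x :=
  h.self_of_nhds.mdifferentiableAt (by simp)

lemma SmoothNear.congr (h : SmoothNear I F σ x) (h' : ∀ᶠ y in 𝓝 x, τ y = σ y) :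
    SmoothNear I F τ x := by
  filter_upwards [h, eventually_eventually_nhds.2 h'] with y hy hy'
  exact hy.congr_of_eventuallyEq (hy'.mono fun z hz ↦ by simp [hz])

lemma FunSmoothNear.eventually (h : FunSmoothNear I f x) : ∀ᶠ y in 𝓝 x, FunSmoothNear I f y :=
  eventually_eventually_nhds.2 h

lemma FunSmoothNear.mdifferentiableAt (h : FunSmoothNear I f x) : MDiffAt f x :=
  h.self_of_nhds.mdifferentiableAt (by simp)

lemma FunSmoothNear.congr (h : FunSmoothNear I f x) (h' : ∀ᶠ y in 𝓝 x, g y = f y) :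
    FunSmoothNear I g x := by
  filter_upwards [h, eventually_eventually_nhds.2 h'] with y hy hy'
  exact hy.congr_of_eventuallyEq hy'

lemma funSmoothNear_const (c : ℝ) : FunSmoothNear I (fun _ : M ↦ c) x :=
  Eventually.of_forall fun _ ↦ contMDiffAt_const

variable [∀ x, AddCommGroup (V x)] [∀ x, Module ℝ (V x)] [VectorBundle ℝ F V]

lemma SmoothNear.add (h : SmoothNear I F σ x) (h' : SmoothNear I F τ x) :
    SmoothNear I F (σ + τ) x := by
  filter_upwards [h, h'] with y hy hy' using hy.add_section hy'

lemma SmoothNear.sub (h : SmoothNear I F σ x) (h' : SmoothNear I F τ x) :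
    SmoothNear I F (σ - τ) x := by
  filter_upwards [h, h'] with y hy hy' using hy.sub_section hy'

lemma SmoothNear.smul (hf : FunSmoothNear I f x) (h : SmoothNear I F σ x) :
    SmoothNear I F (f • σ) x := by
  filter_upwards [hf, h] with y hy hy' using hy.smul_section hy'

lemma smoothNear_zero : SmoothNear I F (0 : Π x : M, V x) x :=
  Eventually.of_forall fun _ ↦ contMDiff_zeroSection ℝ V _

lemma SmoothNear.sum {ι : Type*} {s : Finset ι} {t : ι → Π x : M, V x}
    (h : ∀ i ∈ s, SmoothNear I F (t i) x) : SmoothNear I F (fun y ↦ ∑ i ∈ s, t i y) x := by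
  have : ∀ᶠ y in 𝓝 x, ∀ i ∈ s, CMDiffAt ∞ (T% (t i)) y := (s.eventually_all).2 h
  filter_upwards [this] with y hy using ContMDiffAt.sum_section hy

lemma smoothNear_extend [ContMDiffVectorBundle ∞ F V I] (v : V x) :
    SmoothNear I F (extend F v) x := by
  obtain ⟨s, hs, h⟩ := FiberBundle.exists_contMDiffOn_extend (k := ∞) I F v
  filter_upwards [eventually_eventually_nhds.2 hs] with y hy
  exact h.contMDiffAt hy

/-- A section smooth near a point agrees there with a globally smooth section. -/
lemma SmoothNear.exists_contMDiff [FiniteDimensional ℝ B] [T2Space M] [IsManifold I ∞ M]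
    (h : SmoothNear I F σ x) :
    ∃ τ : Π x : M, V x, CMDiff ∞ (T% τ) ∧ ∀ᶠ y in 𝓝 x, τ y = σ y := by
  obtain ⟨u, hu, hu', hxu⟩ := eventually_nhds_iff.1 h
  obtain ⟨ψ, -, hψ⟩ := (SmoothBumpFunction.nhds_basis_tsupport (I := I) x).mem_iff.1
    (hu'.mem_nhds hxu)
  refine ⟨(ψ : M → ℝ) • σ, ContMDiffOn.smul_section_of_tsupport (u := u)
    ψ.contMDiff.contMDiffOn hu' hψ fun y hy ↦ (hu y hy).contMDiffWithinAt, ?_⟩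
  filter_upwards [ψ.eventuallyEq_one] with y hy
  simp [hy]

/-- An operation on sections that is additive and homogeneous over functions, on sections smooth
near `x`, depends only on the value of the section at `x`. This is the smooth counterpart of
`TensorialAt.pointwise`; it is needed for operators such as the curvature, which differentiate
the section twice. -/
theorem smooth_tensorial_congr [FiniteDimensional ℝ F] [ContMDiffVectorBundle ∞ F V I]
    {G : Type*} [AddCommGroup G] [Module ℝ G] {Φ : (Π x : M, V x) → G}
    (hadd : ∀ {σ τ}, SmoothNear I F σ x → SmoothNear I F τ x → Φ (σ + τ) = Φ σ + Φ τ)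
    (hsmul : ∀ {f : M → ℝ} {σ}, FunSmoothNear I f x → SmoothNear I F σ x → Φ (f • σ) = f x • Φ σ)
    (hσ : SmoothNear I F σ x) (hτ : SmoothNear I F τ x) (hστ : σ x = τ x) : Φ σ = Φ τ := by
  classical
  have : ContMDiffVectorBundle 1 F V I := ContMDiffVectorBundle.of_le (n := ∞) (by simp)
  have hzero : Φ 0 = 0 := by
    simpa using hsmul (funSmoothNear_const 0) (smoothNear_zero (F := F) (V := V) (x := x))
  -- multiplying by the indicator function of the set of agreement shows that `Φ` is local
  have hloc {σ τ : Π x : M, V x} (hσ : SmoothNear I F σ x) (hτ : SmoothNear I F τ x)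
      (h : ∀ᶠ y in 𝓝 x, σ y = τ y) : Φ σ = Φ τ := by
    let ψ (y : M) : ℝ := if σ y = τ y then 1 else 0
    have hψx : ψ x = 1 := by simp [ψ, h.self_of_nhds]
    have hψ : FunSmoothNear I ψ x :=
      (funSmoothNear_const 1).congr (h.mono fun y hy ↦ by simp [ψ, hy])
    have heq : ψ • σ = ψ • τ := by
      funext y
      by_cases hy : σ y = τ y <;> simp [ψ, hy]
    have h1 := hsmul hψ hσ
    rw [heq, hsmul hψ hτ, hψx, one_smul, one_smul] at h1
    exact h1.symm
  have hsum {ι : Type _} (s : Finset ι) {t : ι → Π x : M, V x}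
      (h : ∀ i ∈ s, SmoothNear I F (t i) x) : Φ (fun y ↦ ∑ i ∈ s, t i y) = ∑ i ∈ s, Φ (t i) := by
    induction s using Finset.induction_on with
    | empty => simpa using! hzero
    | insert a s ha ih =>
      simp only [Finset.mem_insert, forall_eq_or_imp] at h
      rw [Finset.sum_insert ha, ← ih h.2, ← hadd h.1 (SmoothNear.sum h.2)]
      congr 1
      funext y
      simp [Finset.sum_insert ha]
  let e := trivializationAt F V x
  have x_mem : x ∈ e.baseSet := FiberBundle.mem_baseSet_trivializationAt F V x
  let b := Module.Basis.ofVectorSpace ℝ F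
  let s := e.localFrame b
  let c := e.localFrameCoeff I b
  have hmem : ∀ᶠ y in 𝓝 x, y ∈ e.baseSet := e.open_baseSet.mem_nhds x_mem
  have hs (i) : SmoothNear I F (s i) x := by
    filter_upwards [hmem] with y hy using contMDiffAt_localFrame_of_mem ∞ _ b i hy
  have hc {σ : Π x : M, V x} (hσ : SmoothNear I F σ x) (i) :
      FunSmoothNear I (LinearMap.piApply (c i) σ) x := by
    filter_upwards [hmem, hσ] with y hy hy' using contMDiffAt_localFrameCoeff b hy hy' i
  have key {σ : Π x : M, V x} (hσ : SmoothNear I F σ x) :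
      Φ σ = ∑ i, c i x (σ x) • Φ (s i) := by
    have h1 : ∀ i ∈ Finset.univ, SmoothNear I F (LinearMap.piApply (c i) σ • s i) x :=
      fun i _ ↦ SmoothNear.smul (hc hσ i) (hs i)
    calc Φ σ = Φ (fun y ↦ ∑ i, (LinearMap.piApply (c i) σ • s i) y) :=
          hloc hσ (SmoothNear.sum h1) (e.eventually_eq_localFrame_sum_coeff_smul b x_mem)
      _ = ∑ i, c i x (σ x) • Φ (s i) := by
          rw [hsum _ h1]
          exact Finset.sum_congr rfl fun i _ ↦ hsmul (hc hσ i) (hs i)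
  rw [key hσ, key hτ, hστ]

end SmoothSections

section VectorFields

variable {B H M : Type*} [NormedAddCommGroup B] [NormedSpace ℝ B] [TopologicalSpace H]
  {I : ModelWithCorners ℝ B H} [TopologicalSpace M] [ChartedSpace H M]
  [IsManifold I ∞ M] {x : M} {f : M → ℝ} {X Y Z : Π x : M, TangentSpace I x}

lemma FunSmoothNear.mvfderiv_apply (hf : FunSmoothNear I f x) (hY : SmoothNear I B Y x) :
    FunSmoothNear I (fun y ↦ mvfderiv I f y (Y y)) x := by
  filter_upwards [hf, hY] with y hy hy'
  have h1 := hy.mfderiv_const (m := ∞) (by simp)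
  have h2 := ContMDiffAt.clm_apply_of_inCoordinates (b₁ := id) (b₂ := f) (v := Y)
    (ϕ := fun z ↦ mfderiv I 𝓘(ℝ, ℝ) f z) h1 hy' hy
  rw [contMDiffAt_totalSpace] at h2
  simpa [mvfderiv] using! h2.2

variable [CompleteSpace B]

lemma SmoothNear.mlieBracket (hX : SmoothNear I B X x) (hY : SmoothNear I B Y x) :
    SmoothNear I B (mlieBracket I X Y) x := by
  have : IsManifold I (minSmoothness ℝ 2) M := by
    rw [minSmoothness_of_isRCLikeNormedField]; infer_instance
  filter_upwards [hX, hY] with y hy hy'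
  have : IsManifold I (((⊤ : ℕ∞) : WithTop ℕ∞) + 1) M := by simpa
  exact ContMDiffAt.mlieBracket_vectorField (n := ⊤) (m := ⊤) hy hy' (by simp)

lemma mlieBracket_jacobi (hX : SmoothNear I B X x) (hY : SmoothNear I B Y x)
    (hZ : SmoothNear I B Z x) :
    mlieBracket I X (mlieBracket I Y Z) x =
      mlieBracket I (mlieBracket I X Y) Z x + mlieBracket I Y (mlieBracket I X Z) x := by
  have : IsManifold I (minSmoothness ℝ 3) M := by
    rw [minSmoothness_of_isRCLikeNormedField]; infer_instance
  have h2 : minSmoothness ℝ 2 ≤ ∞ := by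
    rw [minSmoothness_of_isRCLikeNormedField]; exact ENat.LEInfty.out
  exact leibniz_identity_mlieBracket_apply (hX.self_of_nhds.of_le h2) (hY.self_of_nhds.of_le h2)
    (hZ.self_of_nhds.of_le h2)

/-- The bracket of vector fields acts on functions as the commutator of derivations. Comparing the
two sides of the Jacobi identity for `X`, `Y` and `f • Z` reduces this to rules for brackets. -/
lemma mvfderiv_mlieBracket (hf : FunSmoothNear I f x) (hX : SmoothNear I B X x)
    (hY : SmoothNear I B Y x) :
    mvfderiv I f x (mlieBracket I X Y x) =
      mvfderiv I (fun y ↦ mvfderiv I f y (Y y)) x (X x)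
        - mvfderiv I (fun y ↦ mvfderiv I f y (X y)) x (Y x) := by
  have inner {X Z : Π x : M, TangentSpace I x} (hZ : SmoothNear I B Z x) :
      ∀ᶠ y in 𝓝 x, mlieBracket I X (f • Z) y =
        ((fun z ↦ mvfderiv I f z (X z)) • Z + f • mlieBracket I X Z) y := by
    filter_upwards [hf.eventually, hZ.eventually] with y hy hy'
    exact mlieBracket_smul_right hy.mdifferentiableAt hy'.mdifferentiableAt
  have outer {X Y Z : Π x : M, TangentSpace I x} (hX : SmoothNear I B X x)
      (hY : SmoothNear I B Y x) (hZ : SmoothNear I B Z x) :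
      mlieBracket I Y (mlieBracket I X (f • Z)) x =
        mvfderiv I (fun y ↦ mvfderiv I f y (X y)) x (Y x) • Z x
          + mvfderiv I f x (X x) • mlieBracket I Y Z x
          + (mvfderiv I f x (Y x) • mlieBracket I X Z x
            + f x • mlieBracket I Y (mlieBracket I X Z) x) := by
    have hXf := hf.mvfderiv_apply hX
    refine (EventuallyEq.mlieBracket_vectorField_eq (V₁ := Y) EventuallyEq.rfl
      (inner (X := X) hZ)).trans ?_
    rw [mlieBracket_add_right (SmoothNear.smul hXf hZ).mdifferentiableAt
        (SmoothNear.smul hf (hX.mlieBracket hZ)).mdifferentiableAt,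
      mlieBracket_smul_right hXf.mdifferentiableAt hZ.mdifferentiableAt,
      mlieBracket_smul_right hf.mdifferentiableAt (hX.mlieBracket hZ).mdifferentiableAt]
  by_cases h : Subsingleton (TangentSpace I x)
  · simp [Subsingleton.elim (X x) 0, Subsingleton.elim (Y x) 0,
      Subsingleton.elim (mlieBracket I X Y x) 0]
  · obtain ⟨z, hz⟩ : ∃ z : TangentSpace I x, z ≠ 0 := by
      have := not_subsingleton_iff_nontrivial.1 h
      exact exists_ne 0
    let Z := extend B z
    have hZ : SmoothNear I B Z x := smoothNear_extend z
    have hZx : Z x = z := extend_apply_self B z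
    have hJ := mlieBracket_jacobi hX hY (SmoothNear.smul hf hZ)
    have hJ' := mlieBracket_jacobi hX hY hZ
    rw [outer hY hX hZ, outer hX hY hZ,
      mlieBracket_smul_right hf.mdifferentiableAt hZ.mdifferentiableAt, hJ', hZx] at hJ
    have : (mvfderiv I f x (mlieBracket I X Y x)
        - (mvfderiv I (fun y ↦ mvfderiv I f y (Y y)) x (X x)
        - mvfderiv I (fun y ↦ mvfderiv I f y (X y)) x (Y x))) • z = 0 := by
      rw [← sub_eq_zero] at hJ
      rw [← neg_eq_zero, ← hJ]
      module
    rcases smul_eq_zero.1 this with h0 | h0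
    · exact sub_eq_zero.1 h0
    · exact absurd h0 hz

end VectorFields

end YangMillsKato

/-! ### Connections and the curvature tensor -/

namespace YangMillsKato

section Connection

variable {B H M : Type*} [NormedAddCommGroup B] [NormedSpace ℝ B] [TopologicalSpace H]
  {I : ModelWithCorners ℝ B H} [TopologicalSpace M] [ChartedSpace H M]
  {F : Type*} [NormedAddCommGroup F] [NormedSpace ℝ F]
  {V : M → Type*} [TopologicalSpace (TotalSpace F V)]
  [∀ x, AddCommGroup (V x)] [∀ x, Module ℝ (V x)] [∀ x, TopologicalSpace (V x)]
  [∀ x, IsTopologicalAddGroup (V x)] [∀ x, ContinuousSMul ℝ (V x)] [FiberBundle F V]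
  {A : CovariantDerivative I F V}
  {x : M} {s t : Π x : M, V x} {X : Π x : M, TangentSpace I x} {f : M → ℝ}

lemma CovariantDerivative.congr (hs : SmoothNear I F s x) (h : ∀ᶠ y in 𝓝 x, t y = s y) :
    A t x = A s x :=
  A.isCovariantDerivativeOnUniv.congr_of_eventuallyEq (hs.congr h).mdifferentiableAt
    hs.mdifferentiableAt univ_mem h

lemma CovariantDerivative.add_apply (hs : SmoothNear I F s x) (ht : SmoothNear I F t x)
    (w : TangentSpace I x) : A (s + t) x w = A s x w + A t x w := by
  rw [A.isCovariantDerivativeOnUniv.add hs.mdifferentiableAt ht.mdifferentiableAt]; rfl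

lemma CovariantDerivative.smul_apply (hf : FunSmoothNear I f x)
    (hs : SmoothNear I F s x) (w : TangentSpace I x) :
    A (f • s) x w = f x • A s x w + mvfderiv I f x w • s x := by
  rw [A.isCovariantDerivativeOnUniv.leibniz hs.mdifferentiableAt hf.mdifferentiableAt]; rfl

variable [VectorBundle ℝ F V]

lemma CovariantDerivative.sub_apply (hs : SmoothNear I F s x) (ht : SmoothNear I F t x)
    (w : TangentSpace I x) : A (s - t) x w = A s x w - A t x w := by
  rw [eq_sub_iff_add_eq, ← CovariantDerivative.add_apply (hs.sub ht) ht, sub_add_cancel]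

variable [FiniteDimensional ℝ B] [T2Space M] [IsManifold I ∞ M] [A.ContMDiffCovariantDerivative ∞]

/-- Smoothness of a connection, which is phrased for global sections, passes to sections that are
only smooth near a point. -/
lemma SmoothNear.covariantDerivative (hs : SmoothNear I F s x) (hX : SmoothNear I B X x) :
    SmoothNear I F (fun y ↦ A s y (X y)) x := by
  obtain ⟨t, ht, hts⟩ := hs.exists_contMDiff
  have hA := (CovariantDerivative.ContMDiffCovariantDerivative.contMDiff
    (cov := A) (k := ∞)).contMDiff (σ := t) (by simpa using ht.contMDiffOn)
  have h1 : SmoothNear I F (fun y ↦ A t y (X y)) x := by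
    filter_upwards [hX] with y hy
    exact ContMDiffAt.clm_bundle_apply (hA.contMDiffAt univ_mem) hy
  refine h1.congr ?_
  filter_upwards [hs.eventually, eventually_eventually_nhds.2 hts] with y hy hy'
  rw [CovariantDerivative.congr hy hy']

end Connection

section Curvature

variable {n : ℕ} {M : Type*} [TopologicalSpace M] [ChartedSpace (EuclideanSpace ℝ (Fin n)) M]
  {W : Type*} [NormedAddCommGroup W] [NormedSpace ℝ W]
  {E : M → Type*} [TopologicalSpace (TotalSpace W E)]
  [∀ x, NormedAddCommGroup (E x)] [∀ x, InnerProductSpace ℝ (E x)] [FiberBundle W E]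
  {A : CovariantDerivative (𝓡 n) W E}
  {x : M} {s t : Π x : M, E x} {X Y Z U V : Π x : M, TangentSpace (𝓡 n) x} {f : M → ℝ}

local notation "𝔼" => EuclideanSpace ℝ (Fin n)

lemma curvatureOp_swap (A : CovariantDerivative (𝓡 n) W E) (X Y : Π x : M, TangentSpace (𝓡 n) x)
    (s : Π x : M, E x) (x : M) :
    curvatureOp A X Y s x = - curvatureOp A Y X s x := by
  simp only [curvatureOp]
  rw [mlieBracket_swap_apply, map_neg]
  abel

variable [IsManifold (𝓡 n) ∞ M]

lemma curvature_swap (u v : TangentSpace (𝓡 n) x) (e : E x) :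
    curvature A x u v e = - curvature A x v u e :=
  curvatureOp_swap ..

variable [T2Space M] [VectorBundle ℝ W E] [A.ContMDiffCovariantDerivative ∞]

lemma SmoothNear.curvatureOp (hX : SmoothNear (𝓡 n) 𝔼 X x) (hY : SmoothNear (𝓡 n) 𝔼 Y x)
    (hs : SmoothNear (𝓡 n) W s x) : SmoothNear (𝓡 n) W (curvatureOp A X Y s) x :=
  (((hs.covariantDerivative hY).covariantDerivative hX).sub
    ((hs.covariantDerivative hX).covariantDerivative hY)).sub
      (hs.covariantDerivative (hX.mlieBracket hY))

lemma curvatureOp_add_left (hX : SmoothNear (𝓡 n) 𝔼 X x) (hZ : SmoothNear (𝓡 n) 𝔼 Z x)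
    (hs : SmoothNear (𝓡 n) W s x) :
    curvatureOp A (X + Z) Y s x = curvatureOp A X Y s x + curvatureOp A Z Y s x := by
  have h : A (fun y ↦ A s y ((X + Z) y)) x (Y x) =
      A (fun y ↦ A s y (X y)) x (Y x) + A (fun y ↦ A s y (Z y)) x (Y x) := by
    rw [← CovariantDerivative.add_apply (hs.covariantDerivative hX) (hs.covariantDerivative hZ)]
    congr 2
    funext y
    simp
  simp only [YangMillsKato.curvatureOp]
  rw [h, mlieBracket_add_left hX.mdifferentiableAt hZ.mdifferentiableAt, Pi.add_apply, map_add,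
    map_add]
  abel

lemma curvatureOp_smul_left (hf : FunSmoothNear (𝓡 n) f x) (hX : SmoothNear (𝓡 n) 𝔼 X x)
    (hs : SmoothNear (𝓡 n) W s x) :
    curvatureOp A (f • X) Y s x = f x • curvatureOp A X Y s x := by
  have h : A (fun y ↦ A s y ((f • X) y)) x (Y x) =
      f x • A (fun y ↦ A s y (X y)) x (Y x) + mvfderiv (𝓡 n) f x (Y x) • A s x (X x) := by
    rw [← CovariantDerivative.smul_apply hf (hs.covariantDerivative hX)]
    congr 2
    funext y
    simp
  simp only [YangMillsKato.curvatureOp]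
  rw [h, mlieBracket_smul_left hf.mdifferentiableAt hX.mdifferentiableAt, Pi.smul_apply', map_smul,
    map_add, map_smul, map_smul]
  module

lemma curvatureOp_add_section (hX : SmoothNear (𝓡 n) 𝔼 X x) (hY : SmoothNear (𝓡 n) 𝔼 Y x)
    (hs : SmoothNear (𝓡 n) W s x) (ht : SmoothNear (𝓡 n) W t x) :
    curvatureOp A X Y (s + t) x = curvatureOp A X Y s x + curvatureOp A X Y t x := by
  have h {X Y : Π x : M, TangentSpace (𝓡 n) x} (hX : SmoothNear (𝓡 n) 𝔼 X x)  :
      A (fun y ↦ A (s + t) y (X y)) x (Y x) =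
        A (fun y ↦ A s y (X y)) x (Y x) + A (fun y ↦ A t y (X y)) x (Y x) := by
    rw [← CovariantDerivative.add_apply (hs.covariantDerivative (A := A) hX)
      (ht.covariantDerivative (A := A) hX)]
    rw [CovariantDerivative.congr
      ((hs.covariantDerivative (A := A) hX).add (ht.covariantDerivative (A := A) hX))]
    filter_upwards [hs.eventually, ht.eventually] with y hy hy'
    exact CovariantDerivative.add_apply hy hy' _
  simp only [YangMillsKato.curvatureOp]
  rw [h hX, h hY, CovariantDerivative.add_apply hs ht]
  abel

/-- Tensoriality of the curvature in the section: the second derivatives of `f` cancel because the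
bracket acts on functions as a commutator. -/
lemma curvatureOp_smul_section (hf : FunSmoothNear (𝓡 n) f x) (hX : SmoothNear (𝓡 n) 𝔼 X x)
    (hY : SmoothNear (𝓡 n) 𝔼 Y x) (hs : SmoothNear (𝓡 n) W s x) :
    curvatureOp A X Y (f • s) x = f x • curvatureOp A X Y s x := by
  have h {X Y : Π x : M, TangentSpace (𝓡 n) x} (hX : SmoothNear (𝓡 n) 𝔼 X x)  :
      A (fun y ↦ A (f • s) y (X y)) x (Y x) =
        f x • A (fun y ↦ A s y (X y)) x (Y x) + mvfderiv (𝓡 n) f x (Y x) • A s x (X x)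
        + (mvfderiv (𝓡 n) f x (X x) • A s x (Y x)
          + mvfderiv (𝓡 n) (fun y ↦ mvfderiv (𝓡 n) f y (X y)) x (Y x) • s x) := by
    have hXs := hs.covariantDerivative (A := A) hX
    have hXf := hf.mvfderiv_apply hX
    rw [← CovariantDerivative.smul_apply hf hXs, ← CovariantDerivative.smul_apply hXf hs,
      ← CovariantDerivative.add_apply (SmoothNear.smul hf hXs) (SmoothNear.smul hXf hs),
      CovariantDerivative.congr ((SmoothNear.smul hf hXs).add (SmoothNear.smul hXf hs))]
    filter_upwards [hf.eventually, hs.eventually] with y hy hy'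
    exact CovariantDerivative.smul_apply hy hy' _
  simp only [YangMillsKato.curvatureOp]
  rw [h hX, h hY, CovariantDerivative.smul_apply hf hs, mvfderiv_mlieBracket hf hX hY]
  module

variable [FiniteDimensional ℝ W] [ContMDiffVectorBundle ∞ W E (𝓡 n)]

/-- The curvature operator is a tensor: its value at `x` depends only on the values at `x` of the
fields involved. -/
theorem curvatureOp_eq_curvature (hX : SmoothNear (𝓡 n) 𝔼 X x) (hY : SmoothNear (𝓡 n) 𝔼 Y x)
    (hs : SmoothNear (𝓡 n) W s x) :
    curvatureOp A X Y s x = curvature A x (X x) (Y x) (s x) := by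
  have left {X Y Z : Π x : M, TangentSpace (𝓡 n) x} (hX : SmoothNear (𝓡 n) 𝔼 X x)
      (hZ : SmoothNear (𝓡 n) 𝔼 Z x) (h : X x = Z x) :
      curvatureOp A X Y s x = curvatureOp A Z Y s x :=
    smooth_tensorial_congr (Φ := fun X ↦ curvatureOp A X Y s x)
      (fun h h' ↦ curvatureOp_add_left h h' hs) (fun hf h ↦ curvatureOp_smul_left hf h hs) hX hZ h
  have hX' := smoothNear_extend (I := 𝓡 n) (F := 𝔼) (X x)
  have hY' := smoothNear_extend (I := 𝓡 n) (F := 𝔼) (Y x)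
  have hs' := smoothNear_extend (I := 𝓡 n) (F := W) (s x)
  rw [curvature, left hX hX' (extend_apply_self ..).symm, curvatureOp_swap,
    left hY hY' (extend_apply_self ..).symm, ← curvatureOp_swap]
  exact smooth_tensorial_congr (F := W)
    (Φ := fun s ↦ curvatureOp A (extend 𝔼 (X x)) (extend 𝔼 (Y x)) s x)
    (fun h h' ↦ curvatureOp_add_section hX' hY' h h')
    (fun hf h ↦ curvatureOp_smul_section hf hX' hY' h) hs hs' (extend_apply_self ..).symm

lemma eventually_curvature_eq (hX : SmoothNear (𝓡 n) 𝔼 X x) (hY : SmoothNear (𝓡 n) 𝔼 Y x)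
    (hs : SmoothNear (𝓡 n) W s x) :
    ∀ᶠ y in 𝓝 x, curvature A y (X y) (Y y) (s y) = curvatureOp A X Y s y := by
  filter_upwards [hX.eventually, hY.eventually, hs.eventually] with y h1 h2 h3
  exact (curvatureOp_eq_curvature h1 h2 h3).symm

lemma SmoothNear.curvature (hX : SmoothNear (𝓡 n) 𝔼 X x) (hY : SmoothNear (𝓡 n) 𝔼 Y x)
    (hs : SmoothNear (𝓡 n) W s x) :
    SmoothNear (𝓡 n) W (fun y ↦ curvature A y (X y) (Y y) (s y)) x :=
  (SmoothNear.curvatureOp hX hY hs).congr (eventually_curvature_eq hX hY hs)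

lemma curvature_add_left (u u' v : TangentSpace (𝓡 n) x) (e : E x) :
    curvature A x (u + u') v e = curvature A x u v e + curvature A x u' v e := by
  have h (v : TangentSpace (𝓡 n) x) := smoothNear_extend (I := 𝓡 n) (F := 𝔼) v
  have he := smoothNear_extend (I := 𝓡 n) (F := W) e
  have := curvatureOp_add_left (A := A) (Y := extend 𝔼 v) (h u) (h u') he
  rw [curvatureOp_eq_curvature ((h u).add (h u')) (h v) he] at this
  simpa using! this

lemma curvature_smul_left (c : ℝ) (u v : TangentSpace (𝓡 n) x) (e : E x) :
    curvature A x (c • u) v e = c • curvature A x u v e := by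
  have h (v : TangentSpace (𝓡 n) x) := smoothNear_extend (I := 𝓡 n) (F := 𝔼) v
  have he := smoothNear_extend (I := 𝓡 n) (F := W) e
  have hc := funSmoothNear_const (I := 𝓡 n) (x := x) c
  have := curvatureOp_smul_left (A := A) (Y := extend 𝔼 v) hc (h u) he
  rw [curvatureOp_eq_curvature (SmoothNear.smul hc (h u)) (h v) he] at this
  simpa using! this

lemma curvature_add_section (u v : TangentSpace (𝓡 n) x) (e e' : E x) :
    curvature A x u v (e + e') = curvature A x u v e + curvature A x u v e' := by
  have h (v : TangentSpace (𝓡 n) x) := smoothNear_extend (I := 𝓡 n) (F := 𝔼) v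
  have he (e : E x) := smoothNear_extend (I := 𝓡 n) (F := W) e
  have := curvatureOp_add_section (A := A) (h u) (h v) (he e) (he e')
  rw [curvatureOp_eq_curvature (h u) (h v) ((he e).add (he e'))] at this
  simpa using! this

lemma curvature_smul_section (c : ℝ) (u v : TangentSpace (𝓡 n) x) (e : E x) :
    curvature A x u v (c • e) = c • curvature A x u v e := by
  have h (v : TangentSpace (𝓡 n) x) := smoothNear_extend (I := 𝓡 n) (F := 𝔼) v
  have he := smoothNear_extend (I := 𝓡 n) (F := W) e
  have hc := funSmoothNear_const (I := 𝓡 n) (x := x) c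
  have := curvatureOp_smul_section (A := A) hc (h u) (h v) he
  rw [curvatureOp_eq_curvature (h u) (h v) (SmoothNear.smul hc he)] at this
  simpa using! this

variable (A) in
/-- The curvature at a point as a trilinear map. -/
def curvatureHom (x : M) :
    TangentSpace (𝓡 n) x →ₗ[ℝ] TangentSpace (𝓡 n) x →ₗ[ℝ] E x →ₗ[ℝ] E x :=
  LinearMap.mk₂ ℝ
    (fun u v ↦
      { toFun := curvature A x u v
        map_add' := curvature_add_section u v
        map_smul' := fun c ↦ curvature_smul_section c u v })
    (fun u u' v ↦ LinearMap.ext fun e ↦ curvature_add_left u u' v e)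
    (fun c u v ↦ LinearMap.ext fun e ↦ curvature_smul_left c u v e)
    (fun u v v' ↦ LinearMap.ext fun e ↦ by
      change curvature A x u (v + v') e = curvature A x u v e + curvature A x u v' e
      rw [curvature_swap, curvature_add_left, neg_add, ← curvature_swap, ← curvature_swap])
    (fun c u v ↦ LinearMap.ext fun e ↦ by
      change curvature A x u (c • v) e = c • curvature A x u v e
      rw [curvature_swap, curvature_smul_left, ← smul_neg, ← curvature_swap])

lemma curvatureHom_apply (u v : TangentSpace (𝓡 n) x) (e : E x) :
    curvatureHom A x u v e = curvature A x u v e := rfl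

end Curvature

end YangMillsKato

/-! ### The covariant derivative of the curvature -/

namespace YangMillsKato

section CovDeriv

variable {n : ℕ} {M : Type*} [TopologicalSpace M] [T2Space M]
  [ChartedSpace (EuclideanSpace ℝ (Fin n)) M] [IsManifold (𝓡 n) ∞ M]
  {W : Type*} [NormedAddCommGroup W] [NormedSpace ℝ W] [FiniteDimensional ℝ W]
  {E : M → Type*} [TopologicalSpace (TotalSpace W E)]
  [∀ x, NormedAddCommGroup (E x)] [∀ x, InnerProductSpace ℝ (E x)]
  [FiberBundle W E] [VectorBundle ℝ W E] [ContMDiffVectorBundle ∞ W E (𝓡 n)]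
  {D : CovariantDerivative (𝓡 n) (EuclideanSpace ℝ (Fin n)) (fun x : M ↦ TangentSpace (𝓡 n) x)}
  {A : CovariantDerivative (𝓡 n) W E} [A.ContMDiffCovariantDerivative ∞]
  {x : M} {s t : Π x : M, E x} {X Y Z U V : Π x : M, TangentSpace (𝓡 n) x} {f : M → ℝ}

local notation "𝔼" => EuclideanSpace ℝ (Fin n)

variable (D A) in
/-- The right-hand side of the product rule that defines `∇F`, for vector fields `U`, `V` and a
section `s`. -/
def covDerivCurvatureOp (U V : Π x : M, TangentSpace (𝓡 n) x) (s : Π x : M, E x) (x : M)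
    (w : TangentSpace (𝓡 n) x) : E x :=
  A (fun y ↦ curvatureHom A y (U y) (V y) (s y)) x w
    - curvatureHom A x (D U x w) (V x) (s x)
    - curvatureHom A x (U x) (D V x w) (s x)
    - curvatureHom A x (U x) (V x) (A s x w)

lemma covDeriv_eq_covDerivCurvatureOp (w u v : TangentSpace (𝓡 n) x) (e : E x) :
    covDeriv D A (curvature A) x w u v e =
      covDerivCurvatureOp D A (extend 𝔼 u) (extend 𝔼 v) (extend W e) x w := by
  simp [covDeriv, covDerivCurvatureOp, curvatureHom_apply]

lemma curvatureHom_swap (u v : TangentSpace (𝓡 n) x) (e : E x) :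
    curvatureHom A x u v e = - curvatureHom A x v u e :=
  curvature_swap ..

lemma SmoothNear.curvatureHom (hU : SmoothNear (𝓡 n) 𝔼 U x) (hV : SmoothNear (𝓡 n) 𝔼 V x)
    (hs : SmoothNear (𝓡 n) W s x) :
    SmoothNear (𝓡 n) W (fun y ↦ curvatureHom A y (U y) (V y) (s y)) x :=
  SmoothNear.curvature hU hV hs

lemma covDerivCurvatureOp_swap (hU : SmoothNear (𝓡 n) 𝔼 U x) (hV : SmoothNear (𝓡 n) 𝔼 V x)
    (hs : SmoothNear (𝓡 n) W s x) (w : TangentSpace (𝓡 n) x) :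
    covDerivCurvatureOp D A U V s x w = - covDerivCurvatureOp D A V U s x w := by
  have h : A (fun y ↦ YangMillsKato.curvatureHom A y (U y) (V y) (s y)) x w =
      - A (fun y ↦ YangMillsKato.curvatureHom A y (V y) (U y) (s y)) x w := by
    have h0 := CovariantDerivative.smul_apply (A := A)
      (funSmoothNear_const (I := 𝓡 n) (x := x) (-1)) (SmoothNear.curvatureHom (A := A) hV hU hs) w
    rw [mvfderiv_const] at h0
    rw [← neg_one_smul ℝ (A _ x w)]
    convert! h0 using 1
    · congr 2
      funext y
      simp [← curvatureHom_swap]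
    · simp
  simp only [covDerivCurvatureOp]
  rw [h, curvatureHom_swap (D U x w), curvatureHom_swap (U x) (D V x w),
    curvatureHom_swap (U x) (V x)]
  abel

lemma covDerivCurvatureOp_congr_left (hU : SmoothNear (𝓡 n) 𝔼 U x) (hZ : SmoothNear (𝓡 n) 𝔼 Z x)
    (hV : SmoothNear (𝓡 n) 𝔼 V x) (hs : SmoothNear (𝓡 n) W s x) (w : TangentSpace (𝓡 n) x)
    (h : U x = Z x) : covDerivCurvatureOp D A U V s x w = covDerivCurvatureOp D A Z V s x w := by
  refine smooth_tensorial_congr (Φ := fun U ↦ covDerivCurvatureOp D A U V s x w) ?_ ?_ hU hZ h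
  · intro U Z hU hZ
    have := CovariantDerivative.add_apply (A := A) (SmoothNear.curvatureHom (A := A) hU hV hs)
      (SmoothNear.curvatureHom (A := A) hZ hV hs) w
    have h1 : (fun y ↦ YangMillsKato.curvatureHom A y ((U + Z) y) (V y) (s y)) =
      (fun y ↦ YangMillsKato.curvatureHom A y (U y) (V y) (s y)) +
        (fun y ↦ YangMillsKato.curvatureHom A y (Z y) (V y) (s y)) := by
      funext y; simp
    simp only [covDerivCurvatureOp]
    rw [h1, this, CovariantDerivative.add_apply hU hZ]
    simp only [Pi.add_apply, map_add, LinearMap.add_apply]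
    abel
  · intro f U hf hU
    have := CovariantDerivative.smul_apply (A := A) hf (SmoothNear.curvatureHom (A := A) hU hV hs) w
    have h1 : (fun y ↦ YangMillsKato.curvatureHom A y ((f • U) y) (V y) (s y)) =
      f • (fun y ↦ YangMillsKato.curvatureHom A y (U y) (V y) (s y)) := by
      funext y; simp
    simp only [covDerivCurvatureOp]
    rw [h1, this, CovariantDerivative.smul_apply hf hU]
    simp only [Pi.smul_apply', map_add, map_smul, LinearMap.add_apply, LinearMap.smul_apply]
    module

/-- The covariant derivative of the curvature may be computed with any smooth local extensions. -/
theorem covDeriv_eq_of_smoothNear (hU : SmoothNear (𝓡 n) 𝔼 U x) (hV : SmoothNear (𝓡 n) 𝔼 V x)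
    (hs : SmoothNear (𝓡 n) W s x) (w : TangentSpace (𝓡 n) x) :
    covDeriv D A (curvature A) x w (U x) (V x) (s x) = covDerivCurvatureOp D A U V s x w := by
  have hU' := smoothNear_extend (I := 𝓡 n) (F := 𝔼) (U x)
  have hV' := smoothNear_extend (I := 𝓡 n) (F := 𝔼) (V x)
  have hs' := smoothNear_extend (I := 𝓡 n) (F := W) (s x)
  rw [covDeriv_eq_covDerivCurvatureOp,
    covDerivCurvatureOp_congr_left hU' hU hV' hs' w (extend_apply_self ..),
    covDerivCurvatureOp_swap hU hV' hs',
    covDerivCurvatureOp_congr_left hV' hV hU hs' w (extend_apply_self ..),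
    ← covDerivCurvatureOp_swap hU hV hs']
  refine smooth_tensorial_congr (F := W) (Φ := fun s ↦ covDerivCurvatureOp D A U V s x w)
    ?_ ?_ hs' hs (extend_apply_self ..)
  · intro s t hs ht
    have := CovariantDerivative.add_apply (A := A) (SmoothNear.curvatureHom (A := A) hU hV hs)
      (SmoothNear.curvatureHom (A := A) hU hV ht) w
    have h1 : (fun y ↦ YangMillsKato.curvatureHom A y (U y) (V y) ((s + t) y)) =
      (fun y ↦ YangMillsKato.curvatureHom A y (U y) (V y) (s y)) +
        (fun y ↦ YangMillsKato.curvatureHom A y (U y) (V y) (t y)) := by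
      funext y; simp
    simp only [covDerivCurvatureOp]
    rw [h1, this, CovariantDerivative.add_apply hs ht]
    simp only [Pi.add_apply, map_add]
    abel
  · intro f s hf hs
    have := CovariantDerivative.smul_apply (A := A) hf (SmoothNear.curvatureHom (A := A) hU hV hs) w
    have h1 : (fun y ↦ YangMillsKato.curvatureHom A y (U y) (V y) ((f • s) y)) =
      f • (fun y ↦ YangMillsKato.curvatureHom A y (U y) (V y) (s y)) := by
      funext y; simp
    simp only [covDerivCurvatureOp]
    rw [h1, this, CovariantDerivative.smul_apply hf hs]
    simp only [Pi.smul_apply', map_add, map_smul]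
    module

lemma covDeriv_curvature_swap (w u v : TangentSpace (𝓡 n) x) (e : E x) :
    covDeriv D A (curvature A) x w u v e = - covDeriv D A (curvature A) x w v u e := by
  rw [covDeriv_eq_covDerivCurvatureOp, covDeriv_eq_covDerivCurvatureOp, covDerivCurvatureOp_swap]
  exacts [smoothNear_extend u, smoothNear_extend v, smoothNear_extend e]

/-- The derivative of the curvature along a vector field, with the second derivatives of the section
written out. -/
lemma covDerivCurvatureOp_expand (hX : SmoothNear (𝓡 n) 𝔼 X x) (hU : SmoothNear (𝓡 n) 𝔼 U x)
    (hV : SmoothNear (𝓡 n) 𝔼 V x) (hs : SmoothNear (𝓡 n) W s x) :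
    covDerivCurvatureOp D A U V s x (X x) =
      A (fun y ↦ A (fun z ↦ A s z (V z)) y (U y)) x (X x)
        - A (fun y ↦ A (fun z ↦ A s z (U z)) y (V y)) x (X x)
        - A (fun y ↦ A s y (mlieBracket (𝓡 n) U V y)) x (X x)
        - curvatureHom A x (D U x (X x)) (V x) (s x)
        - curvatureHom A x (U x) (D V x (X x)) (s x)
        - (A (fun y ↦ A (fun z ↦ A s z (X z)) y (V y)) x (U x)
          - A (fun y ↦ A (fun z ↦ A s z (X z)) y (U y)) x (V x)
          - A (fun y ↦ A s y (X y)) x (mlieBracket (𝓡 n) U V x)) := by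
  have hVs := hs.covariantDerivative (A := A) hV
  have hUs := hs.covariantDerivative (A := A) hU
  have hXs := hs.covariantDerivative (A := A) hX
  have h1 := CovariantDerivative.congr (A := A) (SmoothNear.curvatureOp (A := A) hU hV hs)
    (eventually_curvature_eq hU hV hs)
  have h2 : curvatureHom A x (U x) (V x) (A s x (X x)) =
      curvatureOp A U V (fun y ↦ A s y (X y)) x :=
    (curvatureOp_eq_curvature hU hV hXs).symm
  have h3 : A (curvatureOp A U V s) x (X x) =
      A (fun y ↦ A (fun z ↦ A s z (V z)) y (U y)) x (X x)
        - A (fun y ↦ A (fun z ↦ A s z (U z)) y (V y)) x (X x)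
        - A (fun y ↦ A s y (mlieBracket (𝓡 n) U V y)) x (X x) := by
    rw [← CovariantDerivative.sub_apply (hVs.covariantDerivative hU) (hUs.covariantDerivative hV),
      ← CovariantDerivative.sub_apply
        ((hVs.covariantDerivative hU).sub (hUs.covariantDerivative hV))
        (hs.covariantDerivative (hU.mlieBracket hV))]
    rfl
  simp only [covDerivCurvatureOp, curvatureHom_apply] at h1 h2 ⊢
  rw [h1, h2, h3]
  rfl

/-- The second Bianchi identity. After the third derivatives of the section cancel, there remain
curvature terms that are compared through the vanishing of the torsion, and a derivative along the
cyclic sum of double brackets, which vanishes by the Jacobi identity. -/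
theorem covDeriv_curvature_cyclic (hD : D.torsion = 0) (u v w : TangentSpace (𝓡 n) x) (e : E x) :
    covDeriv D A (curvature A) x w u v e + covDeriv D A (curvature A) x u v w e
      + covDeriv D A (curvature A) x v w u e = 0 := by
  have hs := smoothNear_extend (I := 𝓡 n) (F := W) e
  have h (u : TangentSpace (𝓡 n) x) := smoothNear_extend (I := 𝓡 n) (F := 𝔼) u
  set s := extend W e with hse
  obtain ⟨U, hU, rfl⟩ : ∃ U : Π x : M, TangentSpace (𝓡 n) x, SmoothNear (𝓡 n) 𝔼 U x ∧ U x = u :=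
    ⟨_, h u, extend_apply_self ..⟩
  obtain ⟨V, hV, rfl⟩ : ∃ U : Π x : M, TangentSpace (𝓡 n) x, SmoothNear (𝓡 n) 𝔼 U x ∧ U x = v :=
    ⟨_, h v, extend_apply_self ..⟩
  obtain ⟨X, hX, rfl⟩ : ∃ U : Π x : M, TangentSpace (𝓡 n) x, SmoothNear (𝓡 n) 𝔼 U x ∧ U x = w :=
    ⟨_, h w, extend_apply_self ..⟩
  have hse' : s x = e := extend_apply_self ..
  have tor {X Y : Π x : M, TangentSpace (𝓡 n) x} (hX : SmoothNear (𝓡 n) 𝔼 X x)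
      (hY : SmoothNear (𝓡 n) 𝔼 Y x) :
      D Y x (X x) = D X x (Y x) + mlieBracket (𝓡 n) X Y x := by
    have := D.torsion_eq_zero_iff.1 hD hX.mdifferentiableAt hY.mdifferentiableAt
    rw [← this]; abel
  have op {X Y : Π x : M, TangentSpace (𝓡 n) x} (hX : SmoothNear (𝓡 n) 𝔼 X x)
      (hY : SmoothNear (𝓡 n) 𝔼 Y x) :
      A (fun y ↦ A s y (Y y)) x (X x) - A (fun y ↦ A s y (X y)) x (Y x) =
        curvatureHom A x (X x) (Y x) (s x) + A s x (mlieBracket (𝓡 n) X Y x) := by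
    rw [curvatureHom_apply, ← curvatureOp_eq_curvature hX hY hs, YangMillsKato.curvatureOp]
    abel
  have jac : A s x (mlieBracket (𝓡 n) X (mlieBracket (𝓡 n) U V) x)
      + A s x (mlieBracket (𝓡 n) U (mlieBracket (𝓡 n) V X) x)
      + A s x (mlieBracket (𝓡 n) V (mlieBracket (𝓡 n) X U) x) = 0 := by
    have h1 : mlieBracket (𝓡 n) X V = (-1 : ℝ) • mlieBracket (𝓡 n) V X := by
      rw [neg_one_smul]; exact mlieBracket_swap
    have h2 := mlieBracket_jacobi hX hU hV
    rw [h1, mlieBracket_const_smul_right (hV.mlieBracket hX).mdifferentiableAt,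
      mlieBracket_swap_apply (V := mlieBracket (𝓡 n) X U), neg_one_smul] at h2
    rw [← map_add, ← map_add, h2]
    simp
  have e1 := op hX (hU.mlieBracket hV)
  have e2 := op hU (hV.mlieBracket hX)
  have e3 := op hV (hX.mlieBracket hU)
  rw [← hse', covDeriv_eq_of_smoothNear hU hV hs, covDeriv_eq_of_smoothNear hV hX hs,
    covDeriv_eq_of_smoothNear hX hU hs, covDerivCurvatureOp_expand hX hU hV hs,
    covDerivCurvatureOp_expand hU hV hX hs, covDerivCurvatureOp_expand hV hX hU hs,
    curvatureHom_swap (U x) (D V x (X x)), curvatureHom_swap (V x) (D X x (U x)),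
    curvatureHom_swap (X x) (D U x (V x)), tor hX hU, tor hU hV, tor hV hX]
  rw [curvatureHom_swap] at e1 e2 e3
  simp only [map_add, LinearMap.add_apply]
  linear_combination (norm := module) (-1 : ℝ) • e1 - e2 - e3 - jac

end CovDeriv

end YangMillsKato

/-! ### Smooth orthonormal frames and Hilbert-Schmidt norms -/

namespace YangMillsKato

section OrthonormalFrames

variable {B H M : Type*} [NormedAddCommGroup B] [NormedSpace ℝ B] [TopologicalSpace H]
  {I : ModelWithCorners ℝ B H} [TopologicalSpace M] [ChartedSpace H M]
  {F : Type*} [NormedAddCommGroup F] [NormedSpace ℝ F]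
  {V : M → Type*} [TopologicalSpace (TotalSpace F V)]
  [∀ x, NormedAddCommGroup (V x)] [∀ x, InnerProductSpace ℝ (V x)] [FiberBundle F V]
  {x : M} {σ τ : Π x : M, V x} {f : M → ℝ}

lemma FunSmoothNear.inv (hf : FunSmoothNear I f x) (h : f x ≠ 0) :
    FunSmoothNear I (fun y ↦ (f y)⁻¹) x := by
  filter_upwards [hf, hf.mdifferentiableAt.continuousAt.eventually_ne h] with y hy hy'
  exact hy.inv₀ hy'

lemma FunSmoothNear.sqrt (hf : FunSmoothNear I f x) (h : f x ≠ 0) :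
    FunSmoothNear I (fun y ↦ √(f y)) x := by
  filter_upwards [hf, hf.mdifferentiableAt.continuousAt.eventually_ne h] with y hy hy'
  exact (Real.contDiffAt_sqrt hy').comp_contMDiffAt hy

variable [VectorBundle ℝ F V]

variable (F V) in
/-- The identification of two fibres through the model fibre. -/
def fiberEquiv (x y : M) : V x ≃ₗ[ℝ] V y :=
  ((trivializationAt F V x).continuousLinearEquivAt ℝ x
    (mem_baseSet_trivializationAt F V x)).toLinearEquiv.trans
  ((trivializationAt F V y).continuousLinearEquivAt ℝ y
    (mem_baseSet_trivializationAt F V y)).toLinearEquiv.symm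

variable [IsContMDiffRiemannianBundle I ∞ F V]

lemma SmoothNear.inner (hσ : SmoothNear I F σ x) (hτ : SmoothNear I F τ x) :
    FunSmoothNear I (fun y ↦ inner ℝ (σ y) (τ y)) x := by
  filter_upwards [hσ, hτ] with y hy hy'
  exact ContMDiffAt.inner_bundle hy hy'

/-- Every orthonormal basis of a fibre extends to a smooth orthonormal frame near the base point:
extend its vectors and apply the Gram-Schmidt process. -/
theorem exists_orthonormal_frame [ContMDiffVectorBundle ∞ F V I] {m : ℕ}
    (b : OrthonormalBasis (Fin m) ℝ (V x)) :
    ∃ s : Fin m → Π y : M, V y, (∀ i, SmoothNear I F (s i) x) ∧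
      (∀ᶠ y in 𝓝 x, ∃ b' : OrthonormalBasis (Fin m) ℝ (V y), ∀ i, b' i = s i y) ∧
      ∀ i, s i x = b i := by
  let g (i : Fin m) (y : M) : V y := InnerProductSpace.gramSchmidt ℝ (fun i ↦ extend F (b i) y) i
  have hgx (i) : g i x = b i := by
    have : (fun i ↦ extend F (b i) x) = b := funext fun i ↦ extend_apply_self ..
    simp only [g, this]
    rw [InnerProductSpace.gramSchmidt_of_orthogonal ℝ fun i j hij ↦ b.orthonormal.2 hij]
  have hnx (i) : g i x ≠ 0 := by
    rw [hgx]
    exact b.orthonormal.ne_zero i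
  have hg (i) : SmoothNear I F (g i) x := by
    induction i using WellFoundedLT.induction with
    | ind i ih =>
    have hext := smoothNear_extend (I := I) (F := F) (b i)
    refine (hext.sub (SmoothNear.sum (s := Finset.Iio i)
      (t := fun j ↦ (fun y ↦ inner ℝ (g j y) (extend F (b i) y)) •
        (fun y ↦ (inner ℝ (g j y) (g j y))⁻¹) • g j) fun j hj ↦ ?_)).congr
      (Eventually.of_forall fun y ↦ ?_)
    · have hj' := ih j (Finset.mem_Iio.1 hj)
      exact SmoothNear.smul (hj'.inner hext)
        (SmoothNear.smul ((hj'.inner hj').inv (by simp [hnx])) hj')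
    · have := InnerProductSpace.gramSchmidt_def'' ℝ (fun i ↦ extend F (b i) y) i
      rw [← sub_eq_iff_eq_add] at this
      simp only [g]
      rw [← this]
      simp [div_eq_mul_inv, mul_smul]
  have hnorm (i) := (hg i).inner (hg i)
  refine ⟨fun i ↦ (fun y ↦ (√(inner ℝ (g i y) (g i y)))⁻¹) • g i, fun i ↦
    SmoothNear.smul (((hnorm i).sqrt (by simp [hnx])).inv (by simp [hnx])) (hg i), ?_, fun i ↦ ?_⟩
  · have hne : ∀ᶠ y in 𝓝 x, ∀ i, inner ℝ (g i y) (g i y) ≠ (0 : ℝ) :=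
      eventually_all.2 fun i ↦
        (hnorm i).mdifferentiableAt.continuousAt.eventually_ne (by simp [hnx])
    filter_upwards [hne] with y hy
    have hon : Orthonormal ℝ
        fun i ↦ ((fun y ↦ (√(inner ℝ (g i y) (g i y)))⁻¹) • g i : Π y : M, V y) y := by
      refine ⟨fun i ↦ ?_, fun i j hij ↦ ?_⟩
      · have := hy i
        rw [inner_self_ne_zero] at this
        simp [norm_smul, this]
      · have : inner ℝ (g i y) (g j y) = (0 : ℝ) :=
          InnerProductSpace.gramSchmidt_orthogonal ℝ _ hij
        simp [inner_smul_left, inner_smul_right, this]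
    have : FiniteDimensional ℝ (V x) := b.toBasis.finiteDimensional_of_finite
    have : FiniteDimensional ℝ (V y) := (fiberEquiv F V x y).finiteDimensional
    have hcard : Module.finrank ℝ (V y) = Fintype.card (Fin m) := by
      rw [← (fiberEquiv F V x y).finrank_eq, Module.finrank_eq_card_basis b.toBasis]
    obtain ⟨b', hb'⟩ := Orthonormal.exists_orthonormalBasis_extension_of_card_eq
      (s := Set.univ)
      (v := fun i ↦ ((fun y ↦ (√(inner ℝ (g i y) (g i y)))⁻¹) • g i : Π y : M, V y) y)
      hcard (hon.comp _ Subtype.val_injective)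
    exact ⟨b', fun i ↦ hb' i (Set.mem_univ i)⟩
  · simp [hgx]

end OrthonormalFrames

section HilbertSchmidt

variable {G G' : Type*} [NormedAddCommGroup G] [InnerProductSpace ℝ G] [NormedAddCommGroup G']
  [InnerProductSpace ℝ G'] {ι : Type*} [Fintype ι]

/-- The Hilbert-Schmidt norm of a linear map does not depend on the orthonormal basis. -/
lemma sum_norm_sq_apply_eq [FiniteDimensional ℝ G'] (L : G →ₗ[ℝ] G') {m k : ℕ}
    (b : OrthonormalBasis (Fin m) ℝ G) (c : OrthonormalBasis (Fin k) ℝ G) :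
    ∑ i, ‖L (b i)‖ ^ 2 = ∑ j, ‖L (c j)‖ ^ 2 := by
  have := b.toBasis.finiteDimensional_of_finite
  let d := stdOrthonormalBasis ℝ G'
  have h {m : ℕ} (c : OrthonormalBasis (Fin m) ℝ G) :
      ∑ j, ‖L (c j)‖ ^ 2 = ∑ a, ‖L.adjoint (d a)‖ ^ 2 := by
    simp_rw [← d.sum_sq_norm_inner_right (L _), ← c.sum_sq_norm_inner_left (L.adjoint _),
      LinearMap.adjoint_inner_left]
    exact Finset.sum_comm
  exact (h b).trans (h c).symm

/-- Skew-symmetric variations of an orthonormal basis do not change the Hilbert-Schmidt norm. -/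
lemma sum_inner_apply_eq_zero_of_skew (L : G →ₗ[ℝ] G') (b : OrthonormalBasis ι ℝ G) (g : ι → G)
    (hg : ∀ i j, inner ℝ (g i) (b j) = - inner ℝ (g j) (b i)) :
    ∑ i, inner ℝ (L (g i)) (L (b i)) = 0 := by
  have h : ∑ i, inner ℝ (L (g i)) (L (b i)) =
      ∑ i, ∑ j, inner ℝ (g i) (b j) * inner ℝ (L (b j)) (L (b i)) := by
    refine Finset.sum_congr rfl fun i _ ↦ ?_
    conv_lhs => rw [← b.sum_repr' (g i)]
    simp [map_sum, sum_inner, inner_smul_left, real_inner_comm]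
  have h2 : ∑ i, inner ℝ (L (g i)) (L (b i)) = - ∑ i, inner ℝ (L (g i)) (L (b i)) := by
    conv_lhs => rw [h, Finset.sum_comm]
    rw [h, ← Finset.sum_neg_distrib]
    refine Finset.sum_congr rfl fun i _ ↦ ?_
    rw [← Finset.sum_neg_distrib]
    refine Finset.sum_congr rfl fun j _ ↦ ?_
    rw [hg, real_inner_comm (L (b i)), neg_mul]
  linarith

end HilbertSchmidt

end YangMillsKato

/-! ### The derivative of the norm of the curvature -/

namespace YangMillsKato

section HilbertSchmidtTrilinear

variable {G G' : Type*} [NormedAddCommGroup G] [InnerProductSpace ℝ G] [NormedAddCommGroup G']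
  [InnerProductSpace ℝ G']

lemma sum_norm_sq_trilinear_eq [FiniteDimensional ℝ G'] (T : G →ₗ[ℝ] G →ₗ[ℝ] G' →ₗ[ℝ] G')
    {m m' r r' : ℕ} (b : OrthonormalBasis (Fin m) ℝ G) (b' : OrthonormalBasis (Fin m') ℝ G)
    (c : OrthonormalBasis (Fin r) ℝ G') (c' : OrthonormalBasis (Fin r') ℝ G') :
    ∑ i, ∑ j, ∑ a, ‖T (b i) (b j) (c a)‖ ^ 2 = ∑ i, ∑ j, ∑ a, ‖T (b' i) (b' j) (c' a)‖ ^ 2 := by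
  calc ∑ i, ∑ j, ∑ a, ‖T (b i) (b j) (c a)‖ ^ 2
      = ∑ i, ∑ j, ∑ a, ‖T (b i) (b j) (c' a)‖ ^ 2 :=
        Finset.sum_congr rfl fun i _ ↦ Finset.sum_congr rfl fun j _ ↦
          sum_norm_sq_apply_eq (T (b i) (b j)) c c'
    _ = ∑ i, ∑ a, ∑ j, ‖T (b i) (b j) (c' a)‖ ^ 2 :=
        Finset.sum_congr rfl fun i _ ↦ Finset.sum_comm
    _ = ∑ i, ∑ a, ∑ j, ‖T (b i) (b' j) (c' a)‖ ^ 2 :=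
        Finset.sum_congr rfl fun i _ ↦ Finset.sum_congr rfl fun a _ ↦
          sum_norm_sq_apply_eq ((T (b i)).flip (c' a)) b b'
    _ = ∑ i, ∑ j, ∑ a, ‖T (b i) (b' j) (c' a)‖ ^ 2 :=
        Finset.sum_congr rfl fun i _ ↦ Finset.sum_comm
    _ = ∑ j, ∑ a, ∑ i, ‖T (b i) (b' j) (c' a)‖ ^ 2 := by
        rw [Finset.sum_comm]
        exact Finset.sum_congr rfl fun i _ ↦ Finset.sum_comm
    _ = ∑ j, ∑ a, ∑ i, ‖T (b' i) (b' j) (c' a)‖ ^ 2 :=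
        Finset.sum_congr rfl fun j _ ↦ Finset.sum_congr rfl fun a _ ↦
          sum_norm_sq_apply_eq ((T.flip (b' j)).flip (c' a)) b b'
    _ = ∑ i, ∑ j, ∑ a, ‖T (b' i) (b' j) (c' a)‖ ^ 2 := by
        rw [eq_comm, Finset.sum_comm]
        exact Finset.sum_congr rfl fun i _ ↦ Finset.sum_comm

end HilbertSchmidtTrilinear

section Derivatives

variable {B H M : Type*} [NormedAddCommGroup B] [NormedSpace ℝ B] [TopologicalSpace H]
  {I : ModelWithCorners ℝ B H} [TopologicalSpace M] [ChartedSpace H M] {x : M}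

lemma mvfderiv_congr {f g : M → ℝ} (h : ∀ᶠ y in 𝓝 x, f y = g y) :
    mvfderiv I f x = mvfderiv I g x := by
  ext w
  simp only [mvfderiv, EventuallyEq.mfderiv_eq h]
  rfl

lemma FunSmoothNear.sum {ι : Type*} {u : Finset ι} {f : ι → M → ℝ}
    (hf : ∀ i ∈ u, FunSmoothNear I (f i) x) : FunSmoothNear I (fun y ↦ ∑ i ∈ u, f i y) x := by
  have : ∀ᶠ y in 𝓝 x, ∀ i ∈ u, CMDiffAt ∞ (f i) y := (u.eventually_all).2 hf
  filter_upwards [this] with y hy using contMDiffAt_finsetSum hy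

lemma mvfderiv_sum {ι : Type*} {u : Finset ι} {f : ι → M → ℝ}
    (hf : ∀ i ∈ u, FunSmoothNear I (f i) x) (w : TangentSpace I x) :
    mvfderiv I (fun y ↦ ∑ i ∈ u, f i y) x w = ∑ i ∈ u, mvfderiv I (f i) x w := by
  classical
  induction u using Finset.induction_on with
  | empty => simp [mvfderiv_const]
  | insert a u ha ih =>
    simp only [Finset.mem_insert, forall_eq_or_imp] at hf
    simp only [Finset.sum_insert ha]
    rw [← ih hf.2, mvfderiv_fun_add hf.1.mdifferentiableAt
      (FunSmoothNear.sum hf.2).mdifferentiableAt]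
    rfl

variable {F : Type*} [NormedAddCommGroup F] [NormedSpace ℝ F] [FiniteDimensional ℝ F]
  {V : M → Type*} [TopologicalSpace (TotalSpace F V)]
  [∀ x, NormedAddCommGroup (V x)] [∀ x, InnerProductSpace ℝ (V x)] [FiberBundle F V]
  [VectorBundle ℝ F V] [IsManifold I ∞ M]
  [ContMDiffVectorBundle 1 F V I] [IsContMDiffRiemannianBundle I 1 F V]
  {A : CovariantDerivative I F V} {s t : Π x : M, V x}

lemma mvfderiv_inner (hA : A.IsMetricCompatible) (hs : SmoothNear I F s x)
    (ht : SmoothNear I F t x) (w : TangentSpace I x) :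
    mvfderiv I (fun y ↦ inner ℝ (s y) (t y)) x w =
      inner ℝ (A s x w) (t x) + inner ℝ (s x) (A t x w) := by
  have := hA.mvfderiv_inner_eq (extend B w) hs.mdifferentiableAt ht.mdifferentiableAt
  simpa using! this

/-- The connection coefficients of a metric connection in an orthonormal frame are skew. -/
lemma inner_covariantDerivative_skew (hA : A.IsMetricCompatible) (hs : SmoothNear I F s x)
    (ht : SmoothNear I F t x) {c : ℝ} (h : ∀ᶠ y in 𝓝 x, inner ℝ (s y) (t y) = c)
    (w : TangentSpace I x) :
    inner ℝ (A s x w) (t x) = - inner ℝ (A t x w) (s x) := by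
  have h1 := mvfderiv_inner hA hs ht w
  rw [mvfderiv_congr h, mvfderiv_const, real_inner_comm (A t x w)] at h1
  rw [zero_apply] at h1
  linarith

end Derivatives

section NormDerivative

variable {n : ℕ} {M : Type*} [TopologicalSpace M] [T2Space M]
  [ChartedSpace (EuclideanSpace ℝ (Fin n)) M] [IsManifold (𝓡 n) ∞ M]
  [RiemannianBundle (fun x : M ↦ TangentSpace (𝓡 n) x)]
  {W : Type*} [NormedAddCommGroup W] [NormedSpace ℝ W] [FiniteDimensional ℝ W]
  {E : M → Type*} [TopologicalSpace (TotalSpace W E)]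
  [∀ x, NormedAddCommGroup (E x)] [∀ x, InnerProductSpace ℝ (E x)]
  [FiberBundle W E] [VectorBundle ℝ W E] [ContMDiffVectorBundle ∞ W E (𝓡 n)]
  {D : CovariantDerivative (𝓡 n) (EuclideanSpace ℝ (Fin n)) (fun x : M ↦ TangentSpace (𝓡 n) x)}
  {A : CovariantDerivative (𝓡 n) W E} [A.ContMDiffCovariantDerivative ∞] {x : M}

local notation "𝔼" => EuclideanSpace ℝ (Fin n)

lemma formNorm_curvature_eq {m r : ℕ} (b : OrthonormalBasis (Fin m) ℝ (TangentSpace (𝓡 n) x))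
    (c : OrthonormalBasis (Fin r) ℝ (E x)) :
    formNorm W (curvature A) x =
      √((1 / 2) * ∑ i, ∑ j, ∑ a, ‖curvature A x (b i) (b j) (c a)‖ ^ 2) := by
  have : FiniteDimensional ℝ (E x) := c.toBasis.finiteDimensional_of_finite
  have := sum_norm_sq_trilinear_eq (curvatureHom A x) (tangentONB x) b (fiberONB W E x) c
  simp only [curvatureHom_apply] at this
  rw [formNorm, this]

variable [IsContMDiffRiemannianBundle (𝓡 n) ∞ (EuclideanSpace ℝ (Fin n))
    (fun x : M ↦ TangentSpace (𝓡 n) x)]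
  [IsContMDiffRiemannianBundle (𝓡 n) ∞ W E]

/-- The derivative of `|F|²`, computed in an orthonormal frame: the terms that contain derivatives
of the frame cancel because the connection coefficients are skew. -/
theorem mvfderiv_sum_norm_sq_curvature
    (hD : haveI : IsContMDiffRiemannianBundle (𝓡 n) 1 𝔼 (fun x : M ↦ TangentSpace (𝓡 n) x) :=
      IsContMDiffRiemannianBundle.of_le (n := ∞) ENat.LEInfty.out
      D.IsMetricCompatible) (hA : A.IsMetricCompatible) {m r : ℕ}
    {U : Fin m → Π x : M, TangentSpace (𝓡 n) x} {s : Fin r → Π x : M, E x}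
    (hU : ∀ i, SmoothNear (𝓡 n) 𝔼 (U i) x) (hs : ∀ a, SmoothNear (𝓡 n) W (s a) x)
    (hUon : ∀ᶠ y in 𝓝 x, ∃ b : OrthonormalBasis (Fin m) ℝ (TangentSpace (𝓡 n) y),
      ∀ i, b i = U i y)
    (hson : ∀ᶠ y in 𝓝 x, ∃ c : OrthonormalBasis (Fin r) ℝ (E y), ∀ a, c a = s a y) :
    FunSmoothNear (𝓡 n)
        (fun y ↦ ∑ i, ∑ j, ∑ a, ‖curvature A y (U i y) (U j y) (s a y)‖ ^ 2) x ∧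
      ∀ w, mvfderiv (𝓡 n)
          (fun y ↦ ∑ i, ∑ j, ∑ a, ‖curvature A y (U i y) (U j y) (s a y)‖ ^ 2) x w =
        2 * ∑ i, ∑ j, ∑ a, inner ℝ (covDeriv D A (curvature A) x w (U i x) (U j x) (s a x))
          (curvature A x (U i x) (U j x) (s a x)) := by
  have : IsContMDiffRiemannianBundle (𝓡 n) 1 𝔼 (fun x : M ↦ TangentSpace (𝓡 n) x) :=
    IsContMDiffRiemannianBundle.of_le (n := ∞) ENat.LEInfty.out
  have hR (i j a) := SmoothNear.curvature (A := A) (hU i) (hU j) (hs a)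
  simp_rw [← real_inner_self_eq_norm_sq]
  have h1 (i j a) := (hR i j a).inner (hR i j a)
  have h2 (i j) := FunSmoothNear.sum (u := Finset.univ) fun a _ ↦ h1 i j a
  have h3 (i) := FunSmoothNear.sum (u := Finset.univ) fun j _ ↦ h2 i j
  refine ⟨FunSmoothNear.sum (u := Finset.univ) fun i _ ↦ h3 i, fun w ↦ ?_⟩
  have hone (i j a) : mvfderiv (𝓡 n) (fun y ↦ inner ℝ (curvature A y (U i y) (U j y) (s a y))
        (curvature A y (U i y) (U j y) (s a y))) x w =
      2 * (inner ℝ (covDeriv D A (curvature A) x w (U i x) (U j x) (s a x))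
          (curvatureHom A x (U i x) (U j x) (s a x))
        + inner ℝ (curvatureHom A x (D (U i) x w) (U j x) (s a x))
          (curvatureHom A x (U i x) (U j x) (s a x))
        + inner ℝ (curvatureHom A x (U i x) (D (U j) x w) (s a x))
          (curvatureHom A x (U i x) (U j x) (s a x))
        + inner ℝ (curvatureHom A x (U i x) (U j x) (A (s a) x w))
          (curvatureHom A x (U i x) (U j x) (s a x))) := by
    rw [mvfderiv_inner hA (hR i j a) (hR i j a), real_inner_comm, ← two_mul,
      covDeriv_eq_of_smoothNear (hU i) (hU j) (hs a), ← inner_add_left, ← inner_add_left,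
      ← inner_add_left, covDerivCurvatureOp]
    congr 1
    rw [real_inner_comm]
    congr 1
    simp only [curvatureHom_apply]
    abel
  obtain ⟨b, hb⟩ := hUon.self_of_nhds
  obtain ⟨c, hc⟩ := hson.self_of_nhds
  have skewU (i j) : inner ℝ (D (U i) x w) (b j) = - inner ℝ (D (U j) x w) (b i) := by
    rw [hb, hb]
    refine inner_covariantDerivative_skew hD (hU i) (hU j) (c := if i = j then 1 else 0) ?_ w
    filter_upwards [hUon] with y ⟨b, hb⟩
    rw [← hb, ← hb, OrthonormalBasis.inner_eq_ite]
  have skews (i j) : inner ℝ (A (s i) x w) (c j) = - inner ℝ (A (s j) x w) (c i) := by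
    rw [hc, hc]
    refine inner_covariantDerivative_skew hA (hs i) (hs j) (c := if i = j then 1 else 0) ?_ w
    filter_upwards [hson] with y ⟨b, hb⟩
    rw [← hb, ← hb, OrthonormalBasis.inner_eq_ite]
  have z1 : ∑ i, ∑ j, ∑ a, inner ℝ (curvatureHom A x (D (U i) x w) (U j x) (s a x))
      (curvatureHom A x (U i x) (U j x) (s a x)) = 0 := by
    rw [Finset.sum_comm]
    refine Finset.sum_eq_zero fun j _ ↦ ?_
    rw [Finset.sum_comm]
    refine Finset.sum_eq_zero fun a _ ↦ ?_
    have := sum_inner_apply_eq_zero_of_skew (((curvatureHom A x).flip (U j x)).flip (s a x)) b _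
      skewU
    simpa [hb] using this
  have z2 : ∑ i, ∑ j, ∑ a, inner ℝ (curvatureHom A x (U i x) (D (U j) x w) (s a x))
      (curvatureHom A x (U i x) (U j x) (s a x)) = 0 := by
    refine Finset.sum_eq_zero fun i _ ↦ ?_
    rw [Finset.sum_comm]
    refine Finset.sum_eq_zero fun a _ ↦ ?_
    have := sum_inner_apply_eq_zero_of_skew ((curvatureHom A x (U i x)).flip (s a x)) b _ skewU
    simpa [hb] using this
  have z3 : ∑ i, ∑ j, ∑ a, inner ℝ (curvatureHom A x (U i x) (U j x) (A (s a) x w))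
      (curvatureHom A x (U i x) (U j x) (s a x)) = 0 := by
    refine Finset.sum_eq_zero fun i _ ↦ Finset.sum_eq_zero fun j _ ↦ ?_
    have := sum_inner_apply_eq_zero_of_skew (curvatureHom A x (U i x) (U j x)) c _ skews
    simpa [hc] using this
  calc _ = ∑ i, ∑ j, ∑ a, mvfderiv (𝓡 n) (fun y ↦ inner ℝ
          (curvature A y (U i y) (U j y) (s a y)) (curvature A y (U i y) (U j y) (s a y))) x w := by
        rw [mvfderiv_sum fun i _ ↦ h3 i]
        refine Finset.sum_congr rfl fun i _ ↦ ?_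
        rw [mvfderiv_sum fun j _ ↦ h2 i j]
        refine Finset.sum_congr rfl fun j _ ↦ ?_
        rw [mvfderiv_sum fun a _ ↦ h1 i j a]
    _ = _ := by
        simp_rw [hone, ← Finset.mul_sum, Finset.sum_add_distrib]
        rw [z1, z2, z3]
        simp only [add_zero, curvatureHom_apply]

end NormDerivative

end YangMillsKato

/-! ### The refined Kato inequality -/

namespace YangMillsKato

section LocalMinimum

variable {n : ℕ} {M : Type*} [TopologicalSpace M] [ChartedSpace (EuclideanSpace ℝ (Fin n)) M]

lemma mvfderiv_eq_zero_of_isLocalMin {f : M → ℝ} {x : M} (h : IsLocalMin f x) :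
    mvfderiv (𝓡 n) f x = 0 := by
  suffices mfderiv (𝓡 n) 𝓘(ℝ, ℝ) f x = 0 by
    rw [mvfderiv, this]; simp
  by_cases hf : MDifferentiableAt (𝓡 n) 𝓘(ℝ, ℝ) f x
  · simp only [mfderiv, hf, writtenInExtChartAt, modelWithCornersSelf_coe, Set.range_id,
      fderivWithin_univ]
    refine IsLocalMin.fderiv_eq_zero ?_
    have hc := continuousAt_extChartAt_symm (I := 𝓡 n) x
    have hx : (extChartAt (𝓡 n) x).symm (extChartAt (𝓡 n) x x) = x := extChartAt_to_inv x
    rw [ContinuousAt, hx] at hc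
    filter_upwards [hc.eventually h] with z hz
    simpa [hx] using! hz
  · exact mfderiv_zero_of_not_mdifferentiableAt hf

end LocalMinimum

section PointwiseKato

variable {n : ℕ} {M : Type*} [TopologicalSpace M] [T2Space M]
  [ChartedSpace (EuclideanSpace ℝ (Fin n)) M] [IsManifold (𝓡 n) ∞ M]
  [RiemannianBundle (fun x : M ↦ TangentSpace (𝓡 n) x)]
  {W : Type*} [NormedAddCommGroup W] [NormedSpace ℝ W] [FiniteDimensional ℝ W]
  {E : M → Type*} [TopologicalSpace (TotalSpace W E)]
  [∀ x, NormedAddCommGroup (E x)] [∀ x, InnerProductSpace ℝ (E x)]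
  [FiberBundle W E] [VectorBundle ℝ W E] [ContMDiffVectorBundle ∞ W E (𝓡 n)]
  {D : CovariantDerivative (𝓡 n) (EuclideanSpace ℝ (Fin n)) (fun x : M ↦ TangentSpace (𝓡 n) x)}
  {A : CovariantDerivative (𝓡 n) W E} [A.ContMDiffCovariantDerivative ∞] {x : M}

lemma curvature_eq_zero_of_sum_norm_sq {m r : ℕ}
    (b : OrthonormalBasis (Fin m) ℝ (TangentSpace (𝓡 n) x)) (c : OrthonormalBasis (Fin r) ℝ (E x))
    (h : ∑ i, ∑ j, ∑ a, ‖curvature A x (b i) (b j) (c a)‖ ^ 2 = 0) : curvature A x = 0 := by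
  have h0 : curvatureHom A x = 0 := by
    refine b.toBasis.ext fun i ↦ b.toBasis.ext fun j ↦ c.toBasis.ext fun a ↦ ?_
    rw [Finset.sum_eq_zero_iff_of_nonneg fun _ _ ↦ by positivity] at h
    have h1 := h i (Finset.mem_univ i)
    rw [Finset.sum_eq_zero_iff_of_nonneg fun _ _ ↦ by positivity] at h1
    have h2 := h1 j (Finset.mem_univ j)
    rw [Finset.sum_eq_zero_iff_of_nonneg fun _ _ ↦ by positivity] at h2
    simpa [curvatureHom_apply] using h2 a (Finset.mem_univ a)
  funext u v e
  rw [← curvatureHom_apply, h0]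
  rfl

/-- The algebraic inequality applied to `F` and `∇F`: the Bianchi identity and the Yang-Mills
equation are its hypotheses. The sums `a k` will turn out to be the derivatives of `|F|² / 2`. -/
theorem refined_kato_curvature (hD : D.torsion = 0) (hYM : IsYangMills D A)
    {a : Fin (Module.finrank ℝ (TangentSpace (𝓡 n) x)) → ℝ}
    (ha : ∀ k, a k = (1 / 2) * ∑ i, ∑ j, ∑ c,
      inner ℝ (covDeriv D A (curvature A) x (tangentONB x k) (tangentONB x i) (tangentONB x j)
        (fiberONB W E x c))
      (curvature A x (tangentONB x i) (tangentONB x j) (fiberONB W E x c))) :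
    (1 + katoConst n) * ∑ k, a k ^ 2 ≤
      covDerivNormSq D A (curvature A) x * formNorm W (curvature A) x ^ 2 := by
  have key := refined_kato_pointwise
    (φ := fun i j ↦ WithLp.toLp 2 fun c ↦
      curvature A x (tangentONB x i) (tangentONB x j) (fiberONB W E x c))
    (ψ := fun k i j ↦ WithLp.toLp 2 fun c ↦
      covDeriv D A (curvature A) x (tangentONB x k) (tangentONB x i) (tangentONB x j)
        (fiberONB W E x c))
    (a := a)
    (fun i j ↦ by ext c; exact curvature_swap ..)
    (fun k i j ↦ by ext c; exact covDeriv_curvature_swap ..)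
    (fun k i j ↦ by ext c; exact covDeriv_curvature_cyclic hD ..)
    (fun j ↦ by
      ext c
      have := hYM x (tangentONB x j) (fiberONB W E x c)
      rw [codifferential, neg_eq_zero] at this
      simpa using! this)
    (fun k ↦ by
      rw [ha]
      simp only [PiLp.inner_apply])
  have hcard : Module.finrank ℝ (TangentSpace (𝓡 n) x) = n :=
    finrank_euclideanSpace_fin (𝕜 := ℝ) (n := n)
  simp only [PiLp.norm_sq_eq_of_L2, Fintype.card_fin, hcard] at key
  rwa [formNorm, Real.sq_sqrt (by positivity)]

end PointwiseKato

lemma covDerivNormSq_nonneg {n : ℕ} {M : Type*} [TopologicalSpace M]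
    [ChartedSpace (EuclideanSpace ℝ (Fin n)) M] [IsManifold (𝓡 n) ∞ M]
    [RiemannianBundle (fun x : M ↦ TangentSpace (𝓡 n) x)]
    {W : Type*} [NormedAddCommGroup W] [NormedSpace ℝ W] [FiniteDimensional ℝ W]
    {E : M → Type*} [TopologicalSpace (TotalSpace W E)]
    [∀ x, NormedAddCommGroup (E x)] [∀ x, InnerProductSpace ℝ (E x)]
    [FiberBundle W E] [VectorBundle ℝ W E]
    (D : CovariantDerivative (𝓡 n) (EuclideanSpace ℝ (Fin n)) (fun x : M ↦ TangentSpace (𝓡 n) x))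
    (A : CovariantDerivative (𝓡 n) W E) (φ : EndForm n E) (x : M) :
    0 ≤ covDerivNormSq D A φ x := by
  refine Finset.sum_nonneg fun k _ ↦ mul_nonneg (by norm_num) ?_
  exact Finset.sum_nonneg fun i _ ↦ Finset.sum_nonneg fun j _ ↦ Finset.sum_nonneg fun a _ ↦
    sq_nonneg _

end YangMillsKato

end

theorem mainTheorem5 {n : ℕ} {M : Type*} [TopologicalSpace M] [T2Space M]
    [SecondCountableTopology M]
    [ChartedSpace (EuclideanSpace ℝ (Fin n)) M] [IsManifold (𝓡 n) ∞ M]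
    [RiemannianBundle (fun x : M ↦ TangentSpace (𝓡 n) x)]
    [IsContMDiffRiemannianBundle (𝓡 n) ∞ (EuclideanSpace ℝ (Fin n))
      (fun x : M ↦ TangentSpace (𝓡 n) x)]
    {W : Type*} [NormedAddCommGroup W] [NormedSpace ℝ W] [FiniteDimensional ℝ W]
    {E : M → Type*} [TopologicalSpace (TotalSpace W E)]
    [∀ x, NormedAddCommGroup (E x)] [∀ x, InnerProductSpace ℝ (E x)]
    [FiberBundle W E] [VectorBundle ℝ W E] [ContMDiffVectorBundle ∞ W E (𝓡 n)]
    [IsContMDiffRiemannianBundle (𝓡 n) ∞ W E]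
    (D : CovariantDerivative (𝓡 n) (EuclideanSpace ℝ (Fin n))
      (fun x : M ↦ TangentSpace (𝓡 n) x))
    (hD : YangMillsKato.IsLeviCivita D)
    (A : CovariantDerivative (𝓡 n) W E) [A.ContMDiffCovariantDerivative ∞]
    (hA : A.IsMetricCompatible)
    (hYM : YangMillsKato.IsYangMills D A) (x : M) :
    (YangMillsKato.curvature A x ≠ 0 →
      MDifferentiableAt (𝓡 n) 𝓘(ℝ, ℝ)
        (YangMillsKato.formNorm W (YangMillsKato.curvature A)) x) ∧
    (MDifferentiableAt (𝓡 n) 𝓘(ℝ, ℝ)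
        (YangMillsKato.formNorm W (YangMillsKato.curvature A)) x →
      YangMillsKato.covDerivNormSq D A (YangMillsKato.curvature A) x ≥
        (1 + YangMillsKato.katoConst n) *
          ‖mvfderiv (𝓡 n) (YangMillsKato.formNorm W (YangMillsKato.curvature A)) x‖ ^ 2) := by
  open YangMillsKato in
  set b := tangentONB (n := n) x with hbdef
  set c := fiberONB W E x with hcdef
  obtain ⟨U, hU, hUon, hUx⟩ := exists_orthonormal_frame (I := 𝓡 n) (F := EuclideanSpace ℝ (Fin n)) b
  obtain ⟨s, hs, hson, hsx⟩ := exists_orthonormal_frame (I := 𝓡 n) (F := W) c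
  obtain ⟨hP, hdP⟩ := mvfderiv_sum_norm_sq_curvature hD.1 hA hU hs hUon hson
  set P : M → ℝ := fun y ↦ ∑ i, ∑ j, ∑ a, ‖curvature A y (U i y) (U j y) (s a y)‖ ^ 2 with hPdef
  have hfP : ∀ᶠ y in nhds x, formNorm W (curvature A) y = √((1 / 2) * P y) := by
    filter_upwards [hUon, hson] with y ⟨b', hb'⟩ ⟨c', hc'⟩
    rw [formNorm_curvature_eq b' c']
    simp only [hPdef, hb', hc']
  have hP0 (y) : 0 ≤ (1 / 2) * P y := by positivity
  have hPx (h : (1 / 2) * P x = 0) : curvature A x = 0 := by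
    refine curvature_eq_zero_of_sum_norm_sq b c ?_
    simpa [hPdef, hUx, hsx] using h
  have hhalf : FunSmoothNear (𝓡 n) (fun y ↦ (1 / 2) * P y) x := by
    filter_upwards [hP] with y hy using contMDiffAt_const.mul hy
  simp only [hUx, hsx] at hdP
  clear_value P
  refine ⟨fun hne ↦ ((hhalf.sqrt (mt hPx hne)).congr hfP).mdifferentiableAt, fun hf ↦ ?_⟩
  have hnd : ‖mvfderiv (𝓡 n) (formNorm W (curvature A)) x‖ ^ 2 =
      ∑ k, mvfderiv (𝓡 n) (formNorm W (curvature A)) x (b k) ^ 2 := b.norm_dual _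
  rw [hnd]
  -- at a zero `|F|` has a minimum, elsewhere one can divide by it
  obtain h0 | hpos := (hP0 x).eq_or_lt
  · have hmin : IsLocalMin (formNorm W (curvature A)) x := by
      refine Filter.Eventually.of_forall fun y ↦ ?_
      rw [hfP.self_of_nhds, ← h0, Real.sqrt_zero]
      exact Real.sqrt_nonneg _
    rw [mvfderiv_eq_zero_of_isLocalMin hmin]
    simpa using covDerivNormSq_nonneg D A (curvature A) x
  · have hff : ∀ᶠ y in nhds x, (formNorm W (curvature A) * formNorm W (curvature A)) y =
        (1 / 2) * P y := by
      filter_upwards [hfP] with y hy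
      rw [Pi.mul_apply, hy, Real.mul_self_sqrt (hP0 y)]
    -- the product rule for `|F|² = P / 2`
    have hder (w : TangentSpace (𝓡 n) x) :
        formNorm W (curvature A) x * mvfderiv (𝓡 n) (formNorm W (curvature A)) x w =
          (1 / 2) * ∑ i, ∑ j, ∑ a, inner ℝ (covDeriv D A (curvature A) x w (b i) (b j) (c a))
            (curvature A x (b i) (b j) (c a)) := by
      have h1 := DFunLike.congr_fun (mvfderiv_congr (I := 𝓡 n) hff) w
      rw [mvfderiv_mul hf hf, mvfderiv_fun_mul (mdifferentiableAt_const ..) hP.mdifferentiableAt,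
        mvfderiv_const] at h1
      simp only [add_apply, smul_apply, smul_eq_mul, smul_zero, add_zero, hdP w] at h1
      linarith
    have key := refined_kato_curvature hD.2 hYM fun k ↦ hder (b k)
    have hpos' : 0 < formNorm W (curvature A) x ^ 2 := by
      rwa [sq, ← Pi.mul_apply, hff.self_of_nhds]
    simp only [mul_pow, ← Finset.mul_sum] at key
    rw [mul_left_comm, mul_comm (formNorm W (curvature A) x ^ 2)] at key
    exact le_of_mul_le_mul_right key hpos'
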